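/- Let $0<\alpha\le\infty$, let $m$ be Lebesgue measure on $[0,\alpha)$, and let $L^0=L^0[0,\alpha)$ be the space of complex-valued Lebesgue measurable functions on $[0,\alpha)$, identified when equal almost everywhere. For $f\in L^0$ let $d(s,f)=m\{t\in[0,\alpha):|f(t)|>s\}$, let $$\mu(t,f)=\inf\{s>0:\ d(s,f)\le t\}\in[0,\infty]\qquad(t\ge 0)$$ be its decreasing rearrangement $\mu(f)=\mu(\cdot,f)$, regarded also as a function on $[0,\alpha)$, and put $\mu(\infty,f)=\lim_{t\to\infty}\mu(t,f)$. For $f,g\in L^0$ write $f\prec g$ if $\int_0^t\mu(f)\le\int_0^t\mu(g)$ for all $t>0$. A strongly symmetric function space on $[0,\alpha)$ is a linear subspace $E\subset L^0$ with a complete norm $\|\cdot\|_E$ such that (a) if $f\in L^0$, $g\in E$ and $\mu(t,f)\le\mu(t,g)$ for all $t\ge0$, then $f\in E$ and $\|f\|_E\le\|g\|_E$; and (b) if $f,g\in E$ and $f\prec g$, then $\|f\|_E\le\|g\|_E$. For an integer $k\ge1$, a point $x$ of a complex normed space $X$ is a $k$-extreme point of the unit ball $B_X$ if $\|x\|=1$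 and $x$ cannot be written as $x=\frac1{k+1}\sum_{i=1}^{k+1}x_i$ with linearly independent $x_1,\dots,x_{k+1}\in X$ of norm $1$. Let $E$ be a strongly symmetric function space on $[0,\alpha)$, let $k\ge1$ and let $f\in L^0$. Then the following are equivalent: (i) $f$ belongs to $E$ and is a $k$-extreme point of $B_E$; (ii) $\mu(f)$ belongs to $E$ and is a $k$-extreme point of $B_E$, and $|f|\ge\mu(\infty,f)$ almost everywhere on $[0,\alpha)$. -/

import Mathlib

open MeasureTheory Set Filter Topology
open scoped ENNReal NNReal

noncomputable section

/-- The half-open interval `[0, α)`, where `α` is a number in `[0, ∞]`. -/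
def halfOpen (α : ℝ≥0∞) : Set ℝ := {t : ℝ | 0 ≤ t ∧ ENNReal.ofReal t < α}

/-- Lebesgue measure `m` on `[0, α)`. -/
abbrev lebesgueOn (α : ℝ≥0∞) : Measure ℝ := volume.restrict (halfOpen α)

/-- `L⁰[0, α)`: complex measurable functions on `[0, α)`, identified when they agree
almost everywhere. -/
abbrev L0 (α : ℝ≥0∞) : Type := ℝ →ₘ[lebesgueOn α] ℂ

/-- The distribution function `d(s, f) = m {t ∈ [0, α) : |f t| > s}`. -/
def distribution {α : ℝ≥0∞} (f : L0 α) (s : ℝ≥0) : ℝ≥0∞ :=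
  lebesgueOn α {t : ℝ | (s : ℝ) < ‖f t‖}

/-- The decreasing rearrangement `μ(t, f) = inf {s > 0 : d(s, f) ≤ t}`, with values in `[0, ∞]`
and `inf ∅ = ∞`. Only `t ≥ 0` matters. -/
def rearr {α : ℝ≥0∞} (f : L0 α) (t : ℝ) : ℝ≥0∞ :=
  ⨅ (s : ℝ≥0) (_ : 0 < s ∧ distribution f s ≤ ENNReal.ofReal t), (s : ℝ≥0∞)

theorem rearr_antitone {α : ℝ≥0∞} (f : L0 α) : Antitone (rearr f) := by
  intro a b hab
  refine le_iInf₂ fun s hs => iInf₂_le s ⟨hs.1, hs.2.trans (ENNReal.ofReal_le_ofReal hab)⟩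

/-- `μ(∞, f) = lim_{t → ∞} μ(t, f)`, written as an infimum since `μ(f)` is decreasing. -/
def rearrAtInfty {α : ℝ≥0∞} (f : L0 α) : ℝ≥0∞ := ⨅ t : ℝ, rearr f t

theorem tendsto_rearr {α : ℝ≥0∞} (f : L0 α) :
    Tendsto (rearr f) atTop (𝓝 (rearrAtInfty f)) :=
  tendsto_atTop_iInf (rearr_antitone f)

/-- The decreasing rearrangement `μ(f)` as an element of `L⁰[0, α)`. For `f ∈ L⁰[0, α)`, either
`μ(t, f) < ∞` for all `t > 0`, or `μ(f)` is identically `∞` (and then it is no element of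
`L⁰[0, α)`; the value here is then `0`, which never lies on a unit sphere). -/
def rearrL0 {α : ℝ≥0∞} (f : L0 α) : L0 α :=
  AEEqFun.mk (fun t : ℝ => (((rearr f t).toReal : ℝ) : ℂ))
    (Complex.measurable_ofReal.comp
      (rearr_antitone f).measurable.ennreal_toReal).aestronglyMeasurable

/-- `f ≺ g`: `∫₀ᵗ μ(f) ≤ ∫₀ᵗ μ(g)` for all `t > 0`. -/
def Submajorized {α : ℝ≥0∞} (f g : L0 α) : Prop :=
  ∀ t : ℝ, 0 < t → ∫⁻ s in Ioo 0 t, rearr f s ≤ ∫⁻ s in Ioo 0 t, rearr g s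

/-- A normed space `E ⊆ L⁰[0, α)`: a linear subspace together with a norm on it. -/
structure NormedFunctionSpace (α : ℝ≥0∞) where
  toSubmodule : Submodule ℂ (L0 α)
  normE : toSubmodule → ℝ
  norm_nonneg' : ∀ f, 0 ≤ normE f
  norm_smul' : ∀ (c : ℂ) (f), normE (c • f) = ‖c‖ * normE f
  norm_add_le' : ∀ f g, normE (f + g) ≤ normE f + normE g
  eq_zero_of_norm' : ∀ f, normE f = 0 → f = 0

namespace NormedFunctionSpace

variable {α : ℝ≥0∞}

instance : CoeSort (NormedFunctionSpace α) Type := ⟨fun E => E.toSubmodule⟩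

instance instNorm (E : NormedFunctionSpace α) : Norm E.toSubmodule := ⟨E.normE⟩

theorem core (E : NormedFunctionSpace α) : NormedSpace.Core ℂ E.toSubmodule where
  norm_nonneg := E.norm_nonneg'
  norm_smul := E.norm_smul'
  norm_triangle := E.norm_add_le'
  norm_eq_zero_iff f := by
    refine ⟨E.eq_zero_of_norm' f, ?_⟩
    rintro rfl
    have h := E.norm_smul' 0 0
    rw [zero_smul, norm_zero, zero_mul] at h
    exact h

instance (E : NormedFunctionSpace α) : NormedAddCommGroup E.toSubmodule :=
  NormedAddCommGroup.ofCore E.core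

instance (E : NormedFunctionSpace α) : NormedSpace ℂ E.toSubmodule :=
  NormedSpace.ofCore E.core

/-- `E` is a symmetric (rearrangement invariant) Banach function space: it is complete, and
`f ∈ L⁰`, `g ∈ E`, `μ(f) ≤ μ(g)` imply `f ∈ E` and `‖f‖ ≤ ‖g‖`. -/
structure IsSymmetric (E : NormedFunctionSpace α) : Prop where
  complete : CompleteSpace E
  symm : ∀ (f : L0 α) (g : E), (∀ t : ℝ, 0 ≤ t → rearr f t ≤ rearr g.1 t) →
    ∃ hf : f ∈ E.toSubmodule, ‖(⟨f, hf⟩ : E)‖ ≤ ‖g‖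

/-- `E` is strongly symmetric: it is symmetric, and `f, g ∈ E`, `f ≺ g` imply `‖f‖ ≤ ‖g‖`. -/
structure IsStronglySymmetric (E : NormedFunctionSpace α) : Prop extends IsSymmetric E where
  norm_le_of_submajorized : ∀ f g : E, Submajorized f.1 g.1 → ‖f‖ ≤ ‖g‖

end NormedFunctionSpace

/-- `x` is a `k`-extreme point of the unit ball of `X`: it lies on the unit sphere and is not an
average of `k + 1` linearly independent elements of the unit sphere. -/
def IsKExtreme (k : ℕ) {X : Type*} [NormedAddCommGroup X] [NormedSpace ℂ X] (x : X) : Prop :=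
  ‖x‖ = 1 ∧ ∀ v : Fin (k + 1) → X, (∀ i, ‖v i‖ = 1) →
    x = (1 / ((k : ℂ) + 1)) • ∑ i, v i → ¬ LinearIndependent ℂ v

/-- The function `f ∈ L⁰[0, α)` belongs to `E` and is a `k`-extreme point of the unit ball
`B_E`. -/
def NormedFunctionSpace.IsKExtremeIn {α : ℝ≥0∞} (E : NormedFunctionSpace α) (k : ℕ)
    (f : L0 α) : Prop :=
  ∃ hf : f ∈ E.toSubmodule, IsKExtreme k (⟨f, hf⟩ : E)

end

/-! ### Distribution function and decreasing rearrangement. -/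

section Rearrangement

variable {α : ℝ≥0∞}

/-! Submajorization is handled through the convex functions `c ↦ ∫ (|f| - c)₊` (`excess`): if the
excess of `f` is nowhere larger than that of `g`, then `f ≺ g`, so the norm of `E` is monotone in
the excess (`norm_le_of_excess_le`).

Let `G` be `k`-extreme, `‖w‖ ≤ 1`, and let the excess of `G` be at most that of `w`. If a uniform
gap `δ` separates the two on `(c₁, c₂)`, then `|G|` takes values in `(c₁, c₂)` only on a null set:
otherwise `G` could be moved by `k` independent small mean-zero functions living there without
leaving the unit ball (`measure_eq_zero_of_isKExtreme`). Across gaps in the values of `|G|` its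
excess is affine while that of `w` is convex, so the two agree everywhere
(`excess_eq_of_isKExtreme`). Taking `w = G`, whose excess is infinite below `μ(∞, G)`, gives `|G| ≥
μ(∞, G)`.

Now let `F` and `G` be equimeasurable, both at least `μ(∞)` in modulus, `G` `k`-extreme, and `F` the
average of `Fᵢ` on the unit sphere. The excess of `F` is at most that of the average of the `μ(Fᵢ)`,
which lies in the unit ball; hence equality holds. Equality forces `Fᵢ = phase(F) φᵢ(|F|)` with `φᵢ`
increasing (`eq_phase_mul_levelValue`). The functions `phase(G) φᵢ(|G|)` then lie on the unit sphere
and average to `G`, so they are dependent, and their linear relation passes to the `Fᵢ`. The theorem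
is this transfer applied to `f` and `μ(f)` in both orders. -/

theorem halfOpen_top : halfOpen ∞ = Ici 0 := by
  ext t; simp [halfOpen]

theorem halfOpen_of_ne_top (h : α ≠ ∞) : halfOpen α = Ico 0 α.toReal := by
  ext t
  simp only [halfOpen, mem_ofPred_eq, mem_Ico, and_congr_right_iff]
  intro ht
  rw [ENNReal.ofReal_lt_iff_lt_toReal ht h]

theorem measurableSet_halfOpen (α : ℝ≥0∞) : MeasurableSet (halfOpen α) := by
  by_cases h : α = ∞
  · rw [h, halfOpen_top]; exact measurableSet_Ici
  · rw [halfOpen_of_ne_top h]; exact measurableSet_Ico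

theorem volume_halfOpen (α : ℝ≥0∞) : volume (halfOpen α) = α := by
  by_cases h : α = ∞
  · rw [h, halfOpen_top, Real.volume_Ici]
  · rw [halfOpen_of_ne_top h, Real.volume_Ico, sub_zero, ENNReal.ofReal_toReal h]

theorem coe_lt_enorm_iff (s : ℝ≥0) (z : ℂ) : (s : ℝ≥0∞) < ‖z‖ₑ ↔ (s : ℝ) < ‖z‖ := by
  rw [enorm_eq_nnnorm, ENNReal.coe_lt_coe, ← NNReal.coe_lt_coe, coe_nnnorm]

theorem distribution_eq (f : L0 α) (s : ℝ≥0) :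
    distribution f s = lebesgueOn α {t | (s : ℝ≥0∞) < ‖f t‖ₑ} := by
  simp only [coe_lt_enorm_iff]; rfl

theorem distribution_antitone (f : L0 α) : Antitone (distribution f) := by
  intro a b hab
  exact measure_mono fun t (ht : (b : ℝ) < ‖f t‖) => lt_of_le_of_lt (NNReal.coe_le_coe.2 hab) ht

theorem distribution_le (f : L0 α) (s : ℝ≥0) : distribution f s ≤ α :=
  (measure_mono (subset_univ _)).trans (by rw [Measure.restrict_apply_univ, volume_halfOpen])

/-- Right-continuity of the distribution function: `{|f| > c}` is the increasing union of `{|f| >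
u}` over `u ↓ c`. -/
theorem exists_gt_lt_distribution (f : L0 α) {T : ℝ≥0∞} {c : ℝ≥0} (h : T < distribution f c) :
    ∃ s, c < s ∧ T < distribution f s := by
  obtain ⟨u, hu, hlt, hlim⟩ := exists_seq_strictAnti_tendsto c
  have hU : {t | (c : ℝ) < ‖f t‖} = ⋃ n, {t | (u n : ℝ) < ‖f t‖} := by
    ext t
    simp only [mem_ofPred_eq, mem_iUnion]
    constructor
    · intro ht
      have : ∀ᶠ n in atTop, u n < ‖f t‖₊ := (tendsto_order.1 hlim).2 _ ht
      obtain ⟨n, hn⟩ := this.exists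
      exact ⟨n, hn⟩
    · rintro ⟨n, hn⟩
      exact lt_trans (NNReal.coe_lt_coe.2 (hlt n)) hn
  have hm : Monotone fun n => {t | (u n : ℝ) < ‖f t‖} := by
    intro a b hab t (ht : (u a : ℝ) < ‖f t‖)
    exact lt_of_le_of_lt (NNReal.coe_le_coe.2 (hu.antitone hab)) ht
  have := tendsto_measure_iUnion_atTop (μ := lebesgueOn α) hm
  rw [← hU] at this
  obtain ⟨n, hn⟩ := ((tendsto_order.1 this).1 T h).exists
  exact ⟨u n, hlt n, hn⟩

/-- The decreasing rearrangement as a function of an extended time. -/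
noncomputable def rearrE (f : L0 α) (T : ℝ≥0∞) : ℝ≥0∞ :=
  ⨅ (s : ℝ≥0) (_ : 0 < s ∧ distribution f s ≤ T), (s : ℝ≥0∞)

theorem rearrE_ofReal (f : L0 α) (t : ℝ) : rearrE f (ENNReal.ofReal t) = rearr f t := rfl

theorem rearrE_antitone (f : L0 α) : Antitone (rearrE f) := by
  intro a b hab
  exact le_iInf₂ fun s hs => iInf₂_le s ⟨hs.1, hs.2.trans hab⟩

/-- The Galois connection between rearrangement and distribution function; right-continuity of the
latter says that the infimum is attained when it is positive and finite. -/
theorem rearrE_le_iff (f : L0 α) (T : ℝ≥0∞) (c : ℝ≥0) :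
    rearrE f T ≤ c ↔ distribution f c ≤ T := by
  constructor
  · intro h
    by_contra! hT
    obtain ⟨s, hcs, hs⟩ := exists_gt_lt_distribution f hT
    have : (s : ℝ≥0∞) ≤ rearrE f T := by
      refine le_iInf₂ fun s' hs' => ENNReal.coe_le_coe.2 ?_
      by_contra! hlt
      exact absurd (hs.trans_le ((distribution_antitone f hlt.le).trans hs'.2)) (lt_irrefl _)
    exact absurd (ENNReal.coe_le_coe.1 (this.trans h)) (not_le.2 hcs)
  · intro h
    refine ENNReal.le_of_forall_pos_le_add fun ε hε _ => ?_
    rw [← ENNReal.coe_add]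
    exact iInf₂_le (c + ε) ⟨by positivity, (distribution_antitone f (by simp)).trans h⟩

theorem coe_lt_rearrE_iff (f : L0 α) (T : ℝ≥0∞) (c : ℝ≥0) :
    (c : ℝ≥0∞) < rearrE f T ↔ T < distribution f c := by
  simpa using (rearrE_le_iff f T c).not

theorem rearrE_mono_of_distribution_le {f g : L0 α} (h : ∀ s, distribution f s ≤ distribution g s)
    (T : ℝ≥0∞) : rearrE f T ≤ rearrE g T :=
  le_iInf₂ fun s hs => iInf₂_le s ⟨hs.1, (h s).trans hs.2⟩

theorem rearrE_eq_zero {f : L0 α} {T : ℝ≥0∞} (h : α ≤ T) : rearrE f T = 0 := by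
  have := (rearrE_le_iff f T 0).2 ((distribution_le f 0).trans h)
  simpa using this

theorem rearr_eq_zero {f : L0 α} {t : ℝ} (h : α ≤ ENNReal.ofReal t) : rearr f t = 0 :=
  rearrE_eq_zero h

theorem setOf_ofReal_lt_inter (D : ℝ≥0∞) (h : D ≤ α) :
    halfOpen α ∩ {t | ENNReal.ofReal t < D} = halfOpen D := by
  ext t
  simp only [halfOpen, mem_inter_iff, mem_ofPred_eq]
  constructor
  · rintro ⟨⟨h1, _⟩, h2⟩; exact ⟨h1, h2⟩
  · rintro ⟨h1, h2⟩; exact ⟨⟨h1, h2.trans_le h⟩, h2⟩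

theorem lebesgueOn_lt_rearr (f : L0 α) (c : ℝ≥0) :
    lebesgueOn α {t | (c : ℝ≥0∞) < rearr f t} = distribution f c := by
  have : {t | (c : ℝ≥0∞) < rearr f t} = {t | ENNReal.ofReal t < distribution f c} := by
    ext t; exact coe_lt_rearrE_iff f _ c
  rw [this, Measure.restrict_apply (measurableSet_lt (by fun_prop) measurable_const), inter_comm,
    setOf_ofReal_lt_inter _ (distribution_le f c), volume_halfOpen]

theorem continuousWithinAt_rearr (f : L0 α) (t : ℝ) :
    ContinuousWithinAt (rearr f) (Ici t) t := by
  refine tendsto_order.2 ⟨fun a ha => ?_, fun a ha => ?_⟩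
  · obtain ⟨c, hac, hct⟩ := ENNReal.lt_iff_exists_nnreal_btwn.1 ha
    have hd : ENNReal.ofReal t < distribution f c := (coe_lt_rearrE_iff f _ c).1 hct
    have : ∀ᶠ s in 𝓝 t, ENNReal.ofReal s < distribution f c :=
      (tendsto_order.1 (ENNReal.continuous_ofReal.tendsto t)).2 _ hd
    filter_upwards [nhdsWithin_le_nhds this] with s hs
    exact hac.trans ((coe_lt_rearrE_iff f _ c).2 hs)
  · filter_upwards [self_mem_nhdsWithin] with s hs
    exact (rearr_antitone f hs).trans_lt ha

theorem ae_lebesgueOn_pos (α : ℝ≥0∞) : ∀ᵐ t ∂lebesgueOn α, 0 < t := by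
  have h0 : ∀ᵐ t : ℝ ∂lebesgueOn α, t ≠ 0 := by
    rw [ae_iff]
    simp only [ne_eq, not_not, ofPred_eq_eq_singleton]
    exact measure_mono_null (le_refl _) (by
      exact (Measure.absolutelyContinuous_of_le Measure.restrict_le_self) (measure_singleton 0))
  filter_upwards [h0, ae_restrict_mem (measurableSet_halfOpen α)] with t h1 h2
  exact lt_of_le_of_ne h2.1 (Ne.symm h1)

/-- Integrals over `[0, α)` of functions vanishing beyond `α`. -/
theorem lintegral_lebesgueOn_eq (V : ℝ → ℝ≥0∞) (hV : ∀ t, α ≤ ENNReal.ofReal t → V t = 0) :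
    ∫⁻ t, V t ∂lebesgueOn α = ∫⁻ t in Ioi 0, V t := by
  rw [← Measure.restrict_congr_set (Ioi_ae_eq_Ici (a := (0 : ℝ))).symm]
  symm
  rw [← lintegral_indicator measurableSet_Ici, ← lintegral_indicator (measurableSet_halfOpen α)]
  congr 1
  ext t
  by_cases h0 : 0 ≤ t
  · by_cases h : ENNReal.ofReal t < α
    · rw [indicator_of_mem (show t ∈ Ici (0:ℝ) from h0),
        indicator_of_mem (show t ∈ halfOpen α from ⟨h0, h⟩)]
    · rw [indicator_of_mem (show t ∈ Ici (0:ℝ) from h0),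
        indicator_of_notMem (fun hh : t ∈ halfOpen α => h hh.2), hV t (not_lt.1 h)]
  · rw [indicator_of_notMem (fun hh : t ∈ Ici (0:ℝ) => h0 hh),
      indicator_of_notMem (fun hh : t ∈ halfOpen α => h0 hh.1)]

/-- The layer-cake formula for `(k - c)₊`; it makes such integrals depend on the distribution only.
-/
theorem lintegral_tsub_eq_lintegral_measure_lt {Z : Type*} [MeasurableSpace Z] {ρ : Measure Z}
    {k : Z → ℝ≥0∞} (hk : AEMeasurable k ρ) (hkt : ∀ᵐ z ∂ρ, k z ≠ ∞) (c : ℝ≥0) :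
    ∫⁻ z, (k z - c) ∂ρ =
      ∫⁻ s in Ioi (0 : ℝ), ρ {z | ((s.toNNReal + c : ℝ≥0) : ℝ≥0∞) < k z} := by
  have h1 : ∫⁻ z, (k z - c) ∂ρ = ∫⁻ z, ENNReal.ofReal ((k z - c).toReal) ∂ρ := by
    refine lintegral_congr_ae ?_
    filter_upwards [hkt] with z hz
    rw [ENNReal.ofReal_toReal (ENNReal.sub_ne_top hz)]
  rw [h1, lintegral_eq_lintegral_meas_lt ρ (ae_of_all _ fun _ => ENNReal.toReal_nonneg)
    (hk.sub_const _).ennreal_toReal]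
  refine setLIntegral_congr_fun measurableSet_Ioi fun s hs => ?_
  refine measure_congr ?_
  filter_upwards [hkt] with z hz
  refine propext ?_
  change s < (k z - c).toReal ↔ _
  rw [← ENNReal.ofReal_lt_iff_lt_toReal (le_of_lt hs) (ENNReal.sub_ne_top hz), lt_tsub_iff_right]
  change _ ↔ ((s.toNNReal + c : ℝ≥0) : ℝ≥0∞) < k z
  rw [ENNReal.coe_add]
  rfl

theorem lintegral_tsub_eq_of_measure_lt_eq {X Y : Type*} [MeasurableSpace X] [MeasurableSpace Y]
    {μ : Measure X} {ν : Measure Y} {g : X → ℝ≥0∞} {h : Y → ℝ≥0∞} (hg : AEMeasurable g μ)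
    (hh : AEMeasurable h ν) (hgt : ∀ᵐ x ∂μ, g x ≠ ∞) (hht : ∀ᵐ y ∂ν, h y ≠ ∞)
    (heq : ∀ c : ℝ≥0, μ {x | (c : ℝ≥0∞) < g x} = ν {y | (c : ℝ≥0∞) < h y}) (c : ℝ≥0) :
    ∫⁻ x, (g x - c) ∂μ = ∫⁻ y, (h y - c) ∂ν := by
  rw [lintegral_tsub_eq_lintegral_measure_lt hg hgt, lintegral_tsub_eq_lintegral_measure_lt hh hht]
  simp only [heq]

end Rearrangement

/-! ### The excess functional and submajorization. -/

section Excess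

variable {α : ℝ≥0∞}

/-- The integral of `(|f| - c)₊`. -/
noncomputable def excess (f : L0 α) (c : ℝ≥0) : ℝ≥0∞ := ∫⁻ t, (‖f t‖ₑ - c) ∂lebesgueOn α

theorem excess_antitone (f : L0 α) : Antitone (excess f) := fun _ _ h =>
  lintegral_mono fun _ => tsub_le_tsub_left (ENNReal.coe_le_coe.2 h) _

theorem measurable_enorm_L0 (f : L0 α) : Measurable fun t => ‖f t‖ₑ := f.measurable.enorm

theorem excess_eq_of_distribution_eq {f g : L0 α}
    (h : ∀ s, distribution f s = distribution g s) (c : ℝ≥0) : excess f c = excess g c :=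
  lintegral_tsub_eq_of_measure_lt_eq (measurable_enorm_L0 f).aemeasurable
    (measurable_enorm_L0 g).aemeasurable (ae_of_all _ fun _ => enorm_ne_top)
    (ae_of_all _ fun _ => enorm_ne_top)
    (fun c => by rw [← distribution_eq, ← distribution_eq, h]) c

theorem measurable_rearr (f : L0 α) : Measurable (rearr f) := (rearr_antitone f).measurable

theorem lintegral_rearr_tsub {f : L0 α} (hf : ∀ t, 0 < t → rearr f t ≠ ∞) (c : ℝ≥0) :
    ∫⁻ t in Ioi 0, (rearr f t - c) = excess f c := by
  rw [← lintegral_lebesgueOn_eq (α := α) (fun t => rearr f t - c)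
    (fun t ht => by simp [rearr_eq_zero ht])]
  refine lintegral_tsub_eq_of_measure_lt_eq (measurable_rearr f).aemeasurable
    (measurable_enorm_L0 f).aemeasurable ?_ (ae_of_all _ fun _ => enorm_ne_top)
    (fun c => by rw [← distribution_eq, lebesgueOn_lt_rearr]) c
  filter_upwards [ae_lebesgueOn_pos α] with t ht using hf t ht

/-- For decreasing `W`, the integral `∫₀ᵗ W` is the minimum over `c` of `c t + ∫ (W - c)₊`, attained
at `c = W t`. This bound and the equality case `lintegral_Ioo_eq` trade integrals of rearrangements
for excesses. -/
theorem lintegral_Ioo_le (W : ℝ → ℝ≥0∞) (c : ℝ≥0) (t : ℝ) :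
    ∫⁻ s in Ioo 0 t, W s ≤ c * ENNReal.ofReal t + ∫⁻ s in Ioi 0, (W s - c) := by
  calc ∫⁻ s in Ioo 0 t, W s ≤ ∫⁻ s in Ioo 0 t, (c + (W s - c)) :=
        lintegral_mono fun s => le_add_tsub
    _ = c * ENNReal.ofReal t + ∫⁻ s in Ioo 0 t, (W s - c) := by
        rw [lintegral_add_left measurable_const, setLIntegral_const, Real.volume_Ioo, sub_zero]
    _ ≤ _ := by
        gcongr
        exact Ioo_subset_Ioi_self

theorem lintegral_Ioo_eq {W : ℝ → ℝ≥0∞} {c : ℝ≥0} {t : ℝ}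
    (h1 : ∀ s ∈ Ioo 0 t, c ≤ W s) (h2 : ∀ s, t ≤ s → W s ≤ c) :
    ∫⁻ s in Ioo 0 t, W s = c * ENNReal.ofReal t + ∫⁻ s in Ioi 0, (W s - c) := by
  have h3 : ∫⁻ s in Ioi 0, (W s - c) = ∫⁻ s in Ioo 0 t, (W s - c) := by
    rw [← lintegral_indicator measurableSet_Ioi, ← lintegral_indicator measurableSet_Ioo]
    congr 1
    ext s
    by_cases hs : s ∈ Ioo 0 t
    · rw [indicator_of_mem hs, indicator_of_mem (show s ∈ Ioi (0 : ℝ) from hs.1)]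
    · rw [indicator_of_notMem hs]
      by_cases h0 : s ∈ Ioi (0 : ℝ)
      · rw [indicator_of_mem h0]
        exact tsub_eq_zero_of_le (h2 s (not_lt.1 fun hh => hs ⟨h0, hh⟩))
      · rw [indicator_of_notMem h0]
  rw [h3]
  calc ∫⁻ s in Ioo 0 t, W s = ∫⁻ s in Ioo 0 t, (c + (W s - c)) :=
        setLIntegral_congr_fun measurableSet_Ioo fun s hs => (add_tsub_cancel_of_le (h1 s hs)).symm
    _ = _ := by
        rw [lintegral_add_left measurable_const, setLIntegral_const, Real.volume_Ioo, sub_zero]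

theorem setLIntegral_enorm_le (f : L0 α) (A : Set ℝ) (c : ℝ≥0) :
    ∫⁻ x in A, ‖f x‖ₑ ∂lebesgueOn α ≤
      c * lebesgueOn α A + ∫⁻ x in A, (‖f x‖ₑ - c) ∂lebesgueOn α := by
  calc ∫⁻ x in A, ‖f x‖ₑ ∂lebesgueOn α ≤ ∫⁻ x in A, (c + (‖f x‖ₑ - c)) ∂lebesgueOn α :=
        lintegral_mono fun s => le_add_tsub
    _ = _ := by rw [lintegral_add_left measurable_const, setLIntegral_const]

theorem setLIntegral_excess_le (f : L0 α) (A : Set ℝ) (c : ℝ≥0) :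
    ∫⁻ x in A, (‖f x‖ₑ - c) ∂lebesgueOn α ≤ excess f c := setLIntegral_le_lintegral _ _

theorem lintegral_Ioo_rearr_le {f : L0 α} (hf : ∀ t, 0 < t → rearr f t ≠ ∞) (c : ℝ≥0) (t : ℝ) :
    ∫⁻ s in Ioo 0 t, rearr f s ≤ c * ENNReal.ofReal t + excess f c := by
  rw [← lintegral_rearr_tsub hf]
  exact lintegral_Ioo_le (rearr f) c t

theorem lintegral_Ioo_rearr_eq {f : L0 α} (hf : ∀ t, 0 < t → rearr f t ≠ ∞) {t : ℝ}
    (ht : 0 < t) :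
    ∫⁻ s in Ioo 0 t, rearr f s =
      (rearr f t).toNNReal * ENNReal.ofReal t + excess f (rearr f t).toNNReal := by
  rw [← lintegral_rearr_tsub hf]
  refine lintegral_Ioo_eq (fun s hs => ?_) (fun s hs => ?_)
  · rw [ENNReal.coe_toNNReal (hf t ht)]; exact rearr_antitone f hs.2.le
  · rw [ENNReal.coe_toNNReal (hf t ht)]; exact rearr_antitone f hs

/-- A Hardy–Littlewood inequality: cut at the height `c = μ(t, f)`, where the right-hand side equals
`c t` plus the excess. -/
theorem setLIntegral_enorm_le_rearr {f : L0 α} (hf : ∀ t, 0 < t → rearr f t ≠ ∞) {A : Set ℝ}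
    {t : ℝ} (ht : 0 ≤ t) (hA : lebesgueOn α A ≤ ENNReal.ofReal t) :
    ∫⁻ x in A, ‖f x‖ₑ ∂lebesgueOn α ≤ ∫⁻ s in Ioo 0 t, rearr f s := by
  rcases ht.eq_or_lt with rfl | ht
  · rw [ENNReal.ofReal_zero, nonpos_iff_eq_zero] at hA
    rw [setLIntegral_measure_zero _ _ hA]
    exact zero_le
  · rw [lintegral_Ioo_rearr_eq hf ht]
    refine (setLIntegral_enorm_le f A (rearr f t).toNNReal).trans ?_
    gcongr
    exact setLIntegral_excess_le f A _

theorem submajorized_of_excess_le {f g : L0 α} (hf : ∀ t, 0 < t → rearr f t ≠ ∞)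
    (hg : ∀ t, 0 < t → rearr g t ≠ ∞) (h : ∀ c, excess f c ≤ excess g c) : Submajorized f g := by
  intro t ht
  rw [lintegral_Ioo_rearr_eq hg ht]
  refine (lintegral_Ioo_rearr_le hf (rearr g t).toNNReal t).trans ?_
  gcongr
  exact h _

theorem rearrL0_ae_eq (f : L0 α) :
    rearrL0 f =ᵐ[lebesgueOn α] fun t => (((rearr f t).toReal : ℝ) : ℂ) := AEEqFun.coeFn_mk _ _

theorem enorm_rearrL0_ae_eq {f : L0 α} (hf : ∀ t, 0 < t → rearr f t ≠ ∞) :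
    ∀ᵐ t ∂lebesgueOn α, ‖rearrL0 f t‖ₑ = rearr f t := by
  filter_upwards [rearrL0_ae_eq f, ae_lebesgueOn_pos α] with t h1 h2
  rw [h1, ← ofReal_norm, Complex.norm_real, Real.norm_of_nonneg ENNReal.toReal_nonneg,
    ENNReal.ofReal_toReal (hf t h2)]

theorem distribution_rearrL0 {f : L0 α} (hf : ∀ t, 0 < t → rearr f t ≠ ∞) (c : ℝ≥0) :
    distribution (rearrL0 f) c = distribution f c := by
  rw [← lebesgueOn_lt_rearr f, distribution_eq]
  refine measure_congr ?_
  filter_upwards [enorm_rearrL0_ae_eq hf] with t ht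
  exact propext (by change _ < _ ↔ _ < _; rw [ht])

/-- If `μ(t, f) = ∞` for some `t > 0`, every `d(s, f)` exceeds `t`. One finite value would force
`d(s, f) → 0` by continuity from above, so all are infinite, `μ(f)` is identically `∞`, and `toReal`
turns it into `0`. -/
theorem rearr_ne_top_of_rearrL0_ne_zero {f : L0 α} (h : rearrL0 f ≠ 0) (t : ℝ) (ht : 0 < t) :
    rearr f t ≠ ∞ := by
  intro htop
  have hd : ∀ s, ENNReal.ofReal t < distribution f s := fun s =>
    (coe_lt_rearrE_iff f _ s).1 (by rw [rearrE_ofReal, htop]; exact ENNReal.coe_lt_top)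
  have hall : ∀ s, distribution f s = ∞ := by
    by_contra! hex
    obtain ⟨s, hs⟩ := hex
    have hanti : Antitone fun n : ℕ => {x | ((s + n : ℝ≥0) : ℝ) < ‖f x‖} := by
      intro a b hab x (hx : ((s + b : ℝ≥0) : ℝ) < ‖f x‖)
      refine lt_of_le_of_lt (NNReal.coe_le_coe.2 ?_) hx
      gcongr
    have hlim := tendsto_measure_iInter_atTop (μ := lebesgueOn α)
      (fun n => (measurableSet_lt measurable_const f.measurable.norm).nullMeasurableSet) hanti
      ⟨0, by simpa [distribution] using hs⟩
    have hemp : ⋂ n : ℕ, {x | ((s + n : ℝ≥0) : ℝ) < ‖f x‖} = ∅ := by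
      ext x
      simp only [mem_iInter, mem_empty_iff_false, iff_false, not_forall]
      obtain ⟨n, hn⟩ := exists_nat_ge ‖f x‖
      refine ⟨n, fun hh => ?_⟩
      have h1 : ((s + n : ℝ≥0) : ℝ) < ‖f x‖ := hh
      push_cast at h1
      linarith [s.coe_nonneg]
    rw [hemp, measure_empty] at hlim
    obtain ⟨n, hn⟩ := ((tendsto_order.1 hlim).2 (ENNReal.ofReal t) (by simpa using ht)).exists
    exact absurd (hd (s + n)) (not_lt.2 hn.le)
  refine h (AEEqFun.ext ?_)
  filter_upwards [rearrL0_ae_eq f, AEEqFun.coeFn_zero (μ := lebesgueOn α) (β := ℂ)] with x h1 h2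
  have : rearr f x = ∞ := by
    rw [← rearrE_ofReal]
    refine ENNReal.eq_top_of_forall_nnreal_le fun r => ?_
    exact ((coe_lt_rearrE_iff f _ r).2 (by rw [hall]; exact ENNReal.ofReal_lt_top)).le
  rw [h1, h2, this]
  simp

end Excess

/-! ### Consequences of strong symmetry. -/

section Space

variable {α : ℝ≥0∞} {E : NormedFunctionSpace α}

open NormedFunctionSpace

theorem NormedFunctionSpace.IsSymmetric.mem_of_distribution_le (hE : E.IsSymmetric) {f : L0 α}
    (g : E) (h : ∀ s, distribution f s ≤ distribution g.1 s) :
    ∃ hf : f ∈ E.toSubmodule, ‖(⟨f, hf⟩ : E)‖ ≤ ‖g‖ :=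
  hE.symm f g fun _ _ => rearrE_mono_of_distribution_le h _

/-- An infinite integral can only come from a singularity at `0`, so it would be infinite for every
`t > 0`. Then `2g ≺ g`, whence `‖2g‖ ≤ ‖g‖` and `g = 0`, which is absurd. -/
theorem lintegral_rearr_ne_top (hE : E.IsStronglySymmetric) (g : E) (t : ℝ) :
    ∫⁻ s in Ioo 0 t, rearr g.1 s ≠ ∞ := by
  intro htop
  have h0 : ∀ τ, 0 < τ → ∫⁻ s in Ioo 0 τ, rearr g.1 s = ∞ := by
    intro τ hτ
    by_contra hne
    have hfin : rearr g.1 τ ≠ ∞ := by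
      intro h
      refine hne (top_le_iff.1 ?_)
      calc (∞ : ℝ≥0∞) = ∫⁻ s in Ioo 0 τ, ∞ := by
            rw [setLIntegral_const, Real.volume_Ioo, sub_zero, ENNReal.top_mul]
            simpa using hτ
        _ ≤ _ := setLIntegral_mono' measurableSet_Ioo fun s hs => by
            rw [← h]; exact rearr_antitone _ hs.2.le
    have hle : ∫⁻ s in Ioo 0 t, rearr g.1 s ≤
        (∫⁻ s in Ioo 0 τ, rearr g.1 s) + ∫⁻ s in Ico τ t, rearr g.1 s := by
      refine (lintegral_mono_set ?_).trans (lintegral_union_le _ _ _)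
      intro s hs
      rcases lt_or_ge s τ with h | h
      · exact Or.inl ⟨hs.1, h⟩
      · exact Or.inr ⟨h, hs.2⟩
    have h2 : ∫⁻ s in Ico τ t, rearr g.1 s ≤ rearr g.1 τ * ENNReal.ofReal (t - τ) := by
      rw [← Real.volume_Ico, ← setLIntegral_const]
      exact setLIntegral_mono' measurableSet_Ico fun s hs => rearr_antitone _ hs.1
    rw [htop, top_le_iff, ENNReal.add_eq_top] at hle
    rcases hle with h | h
    · exact hne h
    · rw [h, top_le_iff] at h2
      exact ENNReal.mul_ne_top hfin ENNReal.ofReal_ne_top h2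
  have h1 : ‖(2 : ℂ) • g‖ ≤ ‖g‖ := hE.norm_le_of_submajorized _ _ fun τ hτ => by
    rw [h0 τ hτ]; exact le_top
  rw [norm_smul] at h1
  have h2 : ‖g‖ = 0 := by
    have := norm_nonneg g
    norm_num at h1
    linarith
  rw [norm_eq_zero] at h2
  subst h2
  have hz : ∀ s, rearr (0 : L0 α) s = 0 := by
    intro s
    have : rearr (0 : L0 α) s ≤ ((0 : ℝ≥0) : ℝ≥0∞) := by
      rw [← rearrE_ofReal, rearrE_le_iff, distribution_eq]
      refine le_trans (le_of_eq ?_) zero_le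
      rw [← nonpos_iff_eq_zero, nonpos_iff_eq_zero]
      refine measure_eq_zero_iff_ae_notMem.2 ?_
      filter_upwards [AEEqFun.coeFn_zero (μ := lebesgueOn α) (β := ℂ)] with x hx
      simp [hx]
    simpa using this
  simp [hz] at htop

theorem rearr_ne_top (hE : E.IsStronglySymmetric) (g : E) (t : ℝ) (ht : 0 < t) :
    rearr g.1 t ≠ ∞ := by
  intro h
  refine lintegral_rearr_ne_top hE g t (top_le_iff.1 ?_)
  calc (∞ : ℝ≥0∞) = ∫⁻ s in Ioo 0 t, ∞ := by
        rw [setLIntegral_const, Real.volume_Ioo, sub_zero, ENNReal.top_mul]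
        simpa using ht
    _ ≤ _ := setLIntegral_mono' measurableSet_Ioo fun s hs => by
        rw [← h]; exact rearr_antitone _ hs.2.le

theorem norm_le_of_excess_le (hE : E.IsStronglySymmetric) (f g : E)
    (h : ∀ c, excess f.1 c ≤ excess g.1 c) : ‖f‖ ≤ ‖g‖ :=
  hE.norm_le_of_submajorized f g
    (submajorized_of_excess_le (rearr_ne_top hE f) (rearr_ne_top hE g) h)

theorem rearrL0_mem (hE : E.IsStronglySymmetric) (g : E) :
    ∃ h : rearrL0 g.1 ∈ E.toSubmodule, ‖(⟨rearrL0 g.1, h⟩ : E)‖ ≤ ‖g‖ :=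
  hE.toIsSymmetric.mem_of_distribution_le g fun s =>
    (distribution_rearrL0 (rearr_ne_top hE g) s).le

/-- Bounded functions on sets of small measure belong to a nonzero symmetric space. -/
theorem mem_of_bounded (hE : E.IsSymmetric) {g : E} (hg : g ≠ 0) :
    ∃ s : ℝ, 0 < s ∧ ∃ δ : ℝ≥0∞, 0 < δ ∧ ∀ u : L0 α, ∀ S : Set ℝ, lebesgueOn α S ≤ δ →
      (∀ᵐ x ∂lebesgueOn α, ‖u x‖ ≤ s ∧ (x ∉ S → u x = 0)) → u ∈ E.toSubmodule := by
  have h0 : 0 < distribution g.1 0 := by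
    rw [pos_iff_ne_zero]
    intro h
    refine hg (Subtype.ext (AEEqFun.ext ?_))
    rw [distribution_eq] at h
    filter_upwards [measure_eq_zero_iff_ae_notMem.1 h,
      AEEqFun.coeFn_zero (μ := lebesgueOn α) (β := ℂ)] with x hx h2
    simp only [ENNReal.coe_zero, not_lt, nonpos_iff_eq_zero, enorm_eq_zero] at hx
    change g.1 x = (0 : L0 α) x
    rw [hx, h2]; rfl
  -- Since `|g| > s` on a set of measure `δ = d(s, g) > 0`, a function bounded by `s` and living on
  -- a set of measure at most `δ` has a smaller distribution function than `g`.
  obtain ⟨s, hs, hd⟩ := exists_gt_lt_distribution g.1 h0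
  refine ⟨s, hs, _, hd, fun u S hS hu => (hE.mem_of_distribution_le g fun τ => ?_).1⟩
  rcases lt_or_ge τ s with h | h
  · refine le_trans ?_ (hS.trans (distribution_antitone _ h.le))
    refine measure_mono_ae ?_
    filter_upwards [hu] with x hx
    intro (hτ : (τ : ℝ) < ‖u x‖)
    by_contra hxS
    rw [hx.2 hxS, norm_zero] at hτ
    exact absurd hτ (not_lt.2 τ.coe_nonneg)
  · refine le_trans (le_of_eq ?_) zero_le
    refine measure_eq_zero_iff_ae_notMem.2 ?_
    filter_upwards [hu] with x hx
    exact not_lt.2 (hx.1.trans (NNReal.coe_le_coe.2 h))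

end Space

/-! ### A perturbation test for `k`-extreme points, and phases. -/

theorem eq_of_re_eq_of_norm_le {z : ℂ} {p : ℝ} (h1 : z.re = p) (h2 : ‖z‖ ≤ p) : z = p := by
  have hsq : z.re ^ 2 + z.im ^ 2 = ‖z‖ ^ 2 := by
    rw [← Complex.normSq_eq_norm_sq, Complex.normSq_apply]; ring
  have him : z.im = 0 := by
    have : z.im ^ 2 ≤ 0 := by
      rw [h1] at hsq
      nlinarith [norm_nonneg z]
    exact pow_eq_zero_iff two_ne_zero |>.1 (le_antisymm this (sq_nonneg _))
  exact Complex.ext (by simp [h1]) (by simp [him])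

/-- The `k + 1` vectors `x + uⱼ` and `x - ∑ uⱼ` average to `x`. A functional norming `x` must equal
`1` on each of them, so they lie on the unit sphere. Applied to a linear relation it shows that the
coefficients sum to `0`; independence of the `uⱼ` makes them all equal, hence zero. -/
theorem IsKExtreme.false_of_perturbation {k : ℕ} {X : Type*} [NormedAddCommGroup X]
    [NormedSpace ℂ X] {x : X} (h : IsKExtreme k x) (u : Fin k → X) (hu : LinearIndependent ℂ u)
    (h1 : ∀ j, ‖x + u j‖ ≤ 1) (h2 : ‖x - ∑ j, u j‖ ≤ 1) : False := by
  obtain ⟨hx, hv⟩ := h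
  set v : Fin (k + 1) → X := Fin.cons (x - ∑ j, u j) fun j => x + u j with hvdef
  have hle : ∀ i, ‖v i‖ ≤ 1 := by
    intro i
    refine Fin.cases ?_ (fun j => ?_) i
    · simpa [hvdef] using h2
    · simpa [hvdef] using h1 j
  have hk : (k : ℂ) + 1 ≠ 0 := by exact_mod_cast Nat.succ_ne_zero k
  have hsum : ∑ i, v i = ((k : ℂ) + 1) • x := by
    rw [Fin.sum_univ_succ]
    simp only [hvdef, Fin.cons_zero, Fin.cons_succ, Finset.sum_add_distrib, Finset.sum_const,
      Finset.card_univ, Fintype.card_fin, add_smul, one_smul, Nat.cast_smul_eq_nsmul]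
    abel
  obtain ⟨φ, hφ, hφx⟩ := exists_dual_vector ℂ x (by rw [hx]; exact one_ne_zero)
  have hφle : ∀ i, ‖φ (v i)‖ ≤ ‖v i‖ := fun i => by
    have := φ.le_opNorm (v i); rwa [hφ, one_mul] at this
  have hre : ∀ i, (φ (v i)).re ≤ 1 := fun i =>
    (Complex.re_le_norm _).trans ((hφle i).trans (hle i))
  have hφsum : ∑ i, (φ (v i)).re = ∑ _i : Fin (k + 1), (1 : ℝ) := by
    rw [← Complex.re_sum, ← map_sum, hsum, map_smul, hφx, hx]
    simp
  have hre1 : ∀ i, (φ (v i)).re = 1 := fun i =>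
    (Finset.sum_eq_sum_iff_of_le fun i _ => hre i).1 hφsum i (Finset.mem_univ i)
  have hφ1 : ∀ i, φ (v i) = 1 := fun i => by
    simpa using eq_of_re_eq_of_norm_le (hre1 i) ((hφle i).trans (hle i))
  have hnorm : ∀ i, ‖v i‖ = 1 := fun i =>
    le_antisymm (hle i) (by have := hφle i; rwa [hφ1 i, norm_one] at this)
  refine hv v hnorm ?_ ?_
  · rw [hsum, smul_smul, one_div, inv_mul_cancel₀ hk, one_smul]
  · rw [Fintype.linearIndependent_iff]
    intro a ha
    have ha0 : ∑ i, a i = 0 := by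
      have := congrArg φ ha
      simpa [map_sum, hφ1] using this
    have hexp : ∑ i, a i • v i = (∑ i, a i) • x + ∑ j : Fin k, (a j.succ - a 0) • u j := by
      rw [Fin.sum_univ_succ, Fin.sum_univ_succ]
      simp only [hvdef, Fin.cons_zero, Fin.cons_succ, smul_add, sub_smul, add_smul,
        Finset.sum_add_distrib, Finset.sum_sub_distrib, smul_sub, Finset.sum_smul,
        Finset.smul_sum]
      abel
    rw [ha, ha0, zero_smul, zero_add] at hexp
    have hall := Fintype.linearIndependent_iff.1 hu _ hexp.symm
    have h0 : a 0 = 0 := by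
      have : ((k : ℂ) + 1) * a 0 = 0 := by
        rw [← ha0, Fin.sum_univ_succ, Finset.sum_congr rfl fun j _ => sub_eq_zero.1 (hall j)]
        simp; ring
      exact (mul_eq_zero.1 this).resolve_left hk
    intro i
    refine Fin.cases h0 (fun j => ?_) i
    rw [sub_eq_zero.1 (hall j), h0]

/-- The phase of a complex number, with the value `1` at `0`. -/
noncomputable def phase (z : ℂ) : ℂ := if z = 0 then 1 else z / ‖z‖

theorem norm_phase (z : ℂ) : ‖phase z‖ = 1 := by
  unfold phase
  split_ifs with h
  · simp
  · rw [norm_div, Complex.norm_real, norm_norm, div_self (norm_ne_zero_iff.2 h)]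

theorem phase_mul_norm (z : ℂ) : phase z * ‖z‖ = z := by
  unfold phase
  split_ifs with h
  · simp [h]
  · rw [div_mul_cancel₀]
    exact_mod_cast norm_ne_zero_iff.2 h

theorem phase_ne_zero (z : ℂ) : phase z ≠ 0 := by
  rw [← norm_ne_zero_iff, norm_phase]; exact one_ne_zero

theorem measurable_phase : Measurable phase :=
  Measurable.ite (measurableSet_singleton 0) measurable_const
    (measurable_id.div (Complex.measurable_ofReal.comp measurable_norm))

theorem norm_add_phase_mul (z : ℂ) (r : ℝ) : ‖z + phase z * r‖ = |‖z‖ + r| := by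
  have : z + phase z * r = phase z * ((‖z‖ + r : ℝ) : ℂ) := by
    conv_lhs => enter [1]; rw [← phase_mul_norm z]
    push_cast; ring
  rw [this, norm_mul, norm_phase, one_mul, Complex.norm_real, Real.norm_eq_abs]

/-! ### Perturbing inside a window of values. -/

section Perturbation

variable {α : ℝ≥0∞}

theorem coeFn_sum_smul {ι : Type*} [Fintype ι] (c : ι → ℂ) (F : ι → L0 α) :
    ⇑(∑ i, c i • F i) =ᵐ[lebesgueOn α] fun x => ∑ i, c i * F i x := by
  classical
  have : ∀ s : Finset ι, ⇑(∑ i ∈ s, c i • F i) =ᵐ[lebesgueOn α] fun x => ∑ i ∈ s, c i * F i x := by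
    intro s
    induction s using Finset.induction_on with
    | empty =>
      simp only [Finset.sum_empty]
      exact AEEqFun.coeFn_zero
    | insert a s ha ih =>
      rw [Finset.sum_insert ha]
      filter_upwards [ih, AEEqFun.coeFn_add (c a • F a) (∑ i ∈ s, c i • F i),
        AEEqFun.coeFn_smul (c a) (F a)] with x h1 h2 h3
      rw [h2, Pi.add_apply, h1, h3, Finset.sum_insert ha]
      rfl
  exact this _

/-- A real function on `S`, rotated by the phase of `G`. -/
noncomputable def phased (G : L0 α) (r : ℝ → ℝ) (hr : Measurable r) : L0 α :=
  AEEqFun.mk (fun x => phase (G x) * (r x : ℝ))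
    ((measurable_phase.comp G.measurable).mul
      (Complex.measurable_ofReal.comp hr)).aestronglyMeasurable

theorem phased_ae_eq (G : L0 α) (r : ℝ → ℝ) (hr : Measurable r) :
    phased G r hr =ᵐ[lebesgueOn α] fun x => phase (G x) * (r x : ℝ) := AEEqFun.coeFn_mk _ _

theorem norm_add_phased_ae_eq (G : L0 α) (r : ℝ → ℝ) (hr : Measurable r) :
    ∀ᵐ x ∂lebesgueOn α, ‖(G + phased G r hr : L0 α) x‖ₑ = ENNReal.ofReal |‖G x‖ + r x| := by
  filter_upwards [phased_ae_eq G r hr, AEEqFun.coeFn_add G (phased G r hr)] with x h1 h2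
  rw [h2, Pi.add_apply, h1, ← ofReal_norm, norm_add_phase_mul]

/-- The perturbation changes `|G|` by `r` and acts only where `|G|` stays within `[c₁, c₂]`. For `c
≤ c₁` the excess is unchanged because `r` has mean zero; for `c₁ < c < c₂` it grows by at most `∫
|r| ≤ δ`; for `c ≥ c₂` the perturbed points contribute nothing. -/
theorem excess_add_phased_le {G w : L0 α} (hle : ∀ c, excess G c ≤ excess w c) {c₁ c₂ η : ℝ}
    {δ : ℝ≥0∞} (h : ∀ c : ℝ≥0, c₁ < c → c < c₂ → excess G c + δ ≤ excess w c)
    {r : ℝ → ℝ} (hr : Measurable r) (hrη : ∀ x, |r x| ≤ η)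
    (hrG : ∀ x, r x ≠ 0 → c₁ + η ≤ ‖G x‖ ∧ ‖G x‖ ≤ c₂ - η)
    (hrδ : ∫⁻ x, ENNReal.ofReal |r x| ∂lebesgueOn α ≤ δ)
    (hrpos : ∫⁻ x, ENNReal.ofReal (r x) ∂lebesgueOn α =
      ∫⁻ x, ENNReal.ofReal (-r x) ∂lebesgueOn α)
    (hrfin : ∫⁻ x, ENNReal.ofReal (-r x) ∂lebesgueOn α ≠ ∞) (c : ℝ≥0) :
    excess (G + phased G r hr) c ≤ excess w c := by
  have he : excess (G + phased G r hr) c =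
      ∫⁻ x, (ENNReal.ofReal |‖G x‖ + r x| - c) ∂lebesgueOn α := by
    refine lintegral_congr_ae ?_
    filter_upwards [norm_add_phased_ae_eq G r hr] with x hx
    rw [hx]
  have hG : excess G c = ∫⁻ x, (ENNReal.ofReal ‖G x‖ - c) ∂lebesgueOn α := by
    simp only [excess, ofReal_norm]
  rw [he]
  have hc : (c : ℝ≥0∞) = ENNReal.ofReal c := (ENNReal.ofReal_coe_nnreal).symm
  rcases le_or_gt (c : ℝ) c₁ with h1 | h1
  · refine le_trans (le_of_eq ?_) (hle c)
    rw [hG, ← ENNReal.add_left_inj hrfin, ← lintegral_add_right _ (by fun_prop)]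
    conv_rhs => rw [← hrpos]
    rw [← lintegral_add_right _ (by fun_prop)]
    refine lintegral_congr fun x => ?_
    by_cases hx : r x = 0
    · simp [hx]
    · obtain ⟨h3, h4⟩ := hrG x hx
      have h5 := abs_le.1 (hrη x)
      rw [abs_of_nonneg (by linarith [c.coe_nonneg]), hc, ← ENNReal.ofReal_sub _ c.coe_nonneg,
        ← ENNReal.ofReal_sub _ c.coe_nonneg]
      rcases le_total 0 (r x) with h6 | h6
      · rw [ENNReal.ofReal_of_nonpos (neg_nonpos.2 h6), add_zero,
          ← ENNReal.ofReal_add (by linarith) h6]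
        congr 1; ring
      · rw [ENNReal.ofReal_of_nonpos h6, add_zero,
          ← ENNReal.ofReal_add (by linarith) (by linarith)]
        congr 1; ring
  · rcases lt_or_ge (c : ℝ) c₂ with h2 | h2
    · refine le_trans ?_ (h c h1 h2)
      refine le_trans ?_ (add_le_add le_rfl hrδ)
      rw [hG, ← lintegral_add_right _ (by fun_prop)]
      refine lintegral_mono fun x => ?_
      refine le_trans ?_ add_tsub_le_tsub_add
      gcongr
      rw [← ENNReal.ofReal_add (norm_nonneg _) (abs_nonneg _)]
      refine ENNReal.ofReal_le_ofReal ((abs_add_le _ _).trans ?_)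
      rw [abs_norm]
    · refine le_trans ?_ (hle c)
      rw [hG]
      refine lintegral_mono fun x => ?_
      by_cases hx : r x = 0
      · simp [hx]
      · obtain ⟨h3, h4⟩ := hrG x hx
        refine le_trans (le_of_eq (tsub_eq_zero_of_le ?_)) zero_le
        rw [hc]
        refine ENNReal.ofReal_le_ofReal ((abs_add_le _ _).trans ?_)
        rw [abs_norm]
        linarith [hrη x]

end Perturbation

section Perturbation

variable {α : ℝ≥0∞} {E : NormedFunctionSpace α}

theorem exists_subset_Ico_measure_pos {m : Measure ℝ} {T : Set ℝ} (hT : m T ≠ 0) {ε : ℝ}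
    (hε : 0 < ε) : ∃ a : ℝ, m (T ∩ Ico a (a + ε)) ≠ 0 := by
  by_contra! h
  refine hT (measure_mono_null (t := ⋃ n : ℤ, T ∩ Ico (n * ε) (n * ε + ε)) ?_
    (measure_iUnion_null fun n => h _))
  intro x hx
  refine mem_iUnion.2 ⟨⌊x / ε⌋, hx, ?_, ?_⟩
  · have := Int.floor_le (x / ε)
    rwa [le_div_iff₀ hε] at this
  · have := Int.lt_floor_add_one (x / ε)
    rw [div_lt_iff₀ hε] at this
    linarith

theorem exists_measure_Icc_pos {X : Type*} [MeasurableSpace X] {m : Measure X} {g : X → ℝ}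
    {c₁ c₂ : ℝ} (h : m {x | c₁ < g x ∧ g x < c₂} ≠ 0) :
    ∃ η : ℝ, 0 < η ∧ m {x | c₁ + η ≤ g x ∧ g x ≤ c₂ - η} ≠ 0 := by
  by_contra! hη
  refine h (measure_mono_null
    (t := ⋃ n : ℕ, {x | c₁ + 1 / ((n : ℝ) + 1) ≤ g x ∧ g x ≤ c₂ - 1 / ((n : ℝ) + 1)}) ?_
    (measure_iUnion_null fun n => hη _ (by positivity)))
  rintro x ⟨h1, h2⟩
  obtain ⟨n, hn⟩ := exists_nat_one_div_lt (lt_min (sub_pos.2 h1) (sub_pos.2 h2))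
  rw [lt_min_iff] at hn
  exact mem_iUnion.2 ⟨n, by linarith [hn.1], by linarith [hn.2]⟩

/-- There are many small perturbations of `G` which remain in the unit ball. -/
theorem exists_perturbations (hE : E.IsStronglySymmetric) {G w : E} (hG : ‖G‖ = 1)
    (hw : ‖w‖ ≤ 1) (hle : ∀ c, excess G.1 c ≤ excess w.1 c) {c₁ c₂ : ℝ} {δ : ℝ≥0∞} (hδ : 0 < δ)
    (h : ∀ c : ℝ≥0, c₁ < c → c < c₂ → excess G.1 c + δ ≤ excess w.1 c)
    (hpos : lebesgueOn α {x | c₁ < ‖G.1 x‖ ∧ ‖G.1 x‖ < c₂} ≠ 0) :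
    ∃ S : Set ℝ, MeasurableSet S ∧ Bornology.IsBounded S ∧ lebesgueOn α S ≠ 0 ∧
      ∃ τ : ℝ, 0 < τ ∧ ∀ (q : ℝ → ℝ) (hq : Measurable (S.indicator q)), (∀ x ∈ S, |q x| ≤ τ) →
        ∫ x in S, q x ∂lebesgueOn α = 0 →
        ∃ hu : phased G.1 (S.indicator q) hq ∈ E.toSubmodule,
          ‖G + ⟨phased G.1 (S.indicator q) hq, hu⟩‖ ≤ 1 := by
  have hG0 : G ≠ 0 := by rintro rfl; simp at hG
  obtain ⟨s, hs, δ', hδ', hmem⟩ := mem_of_bounded hE.toIsSymmetric hG0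
  obtain ⟨η, hη, hT⟩ := exists_measure_Icc_pos hpos
  set T := {x | c₁ + η ≤ ‖G.1 x‖ ∧ ‖G.1 x‖ ≤ c₂ - η} with hTdef
  have hTm : MeasurableSet T :=
    (measurableSet_le measurable_const G.1.measurable.norm).inter
      (measurableSet_le G.1.measurable.norm measurable_const)
  obtain ⟨ε, hε, hε1⟩ : ∃ ε : ℝ, 0 < ε ∧ ENNReal.ofReal ε ≤ min δ' δ := by
    obtain ⟨ε, hε0, hε⟩ := ENNReal.lt_iff_exists_nnreal_btwn.1 (lt_min hδ' hδ)
    refine ⟨ε, by simpa using hε0, by simpa using hε.le⟩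
  obtain ⟨a, ha⟩ := exists_subset_Ico_measure_pos hT hε
  set S := T ∩ Ico a (a + ε) with hSdef
  have hSm : MeasurableSet S := hTm.inter measurableSet_Ico
  have hSε : lebesgueOn α S ≤ ENNReal.ofReal ε := by
    refine (Measure.restrict_apply_le _ _).trans ?_
    refine (measure_mono inter_subset_right).trans ?_
    rw [Real.volume_Ico]; simp
  -- The bound `η` keeps the modulus in the window, `s` gives membership in `E`, and `1` gives `∫
  -- |q| ≤ m(S) ≤ ε ≤ δ`.
  refine ⟨S, hSm, (Metric.isBounded_Ico a (a + ε)).subset inter_subset_right, ha,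
    min (min η s) 1, by positivity, fun q hq hqτ hq0 => ?_⟩
  have hqη : ∀ x, |S.indicator q x| ≤ min (min η s) 1 := by
    intro x
    by_cases hx : x ∈ S
    · rw [indicator_of_mem hx]; exact hqτ x hx
    · rw [indicator_of_notMem hx, abs_zero]; positivity
  have hu : phased G.1 (S.indicator q) hq ∈ E.toSubmodule := by
    refine hmem _ S (hSε.trans (hε1.trans (min_le_left _ _))) ?_
    filter_upwards [phased_ae_eq G.1 (S.indicator q) hq] with x hx
    rw [hx]
    refine ⟨?_, fun hxS => by rw [indicator_of_notMem hxS]; simp⟩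
    rw [norm_mul, norm_phase, one_mul, Complex.norm_real, Real.norm_eq_abs]
    exact (hqη x).trans ((min_le_left _ _).trans (min_le_right _ _))
  refine ⟨hu, (norm_le_of_excess_le hE _ w ?_).trans hw⟩
  have habs : ∫⁻ x, ENNReal.ofReal |S.indicator q x| ∂lebesgueOn α ≤ ENNReal.ofReal ε := by
    calc ∫⁻ x, ENNReal.ofReal |S.indicator q x| ∂lebesgueOn α
        ≤ ∫⁻ x, S.indicator (fun _ => 1) x ∂lebesgueOn α := by
          refine lintegral_mono fun x => ?_
          by_cases hx : x ∈ S
          · rw [indicator_of_mem hx, indicator_of_mem hx]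
            exact ENNReal.ofReal_le_one.2 ((hqτ x hx).trans (min_le_right _ _))
          · rw [indicator_of_notMem hx, indicator_of_notMem hx]; simp
      _ = lebesgueOn α S := lintegral_indicator_one hSm
      _ ≤ _ := hSε
  have hint : Integrable (S.indicator q) (lebesgueOn α) := by
    refine ⟨hq.aestronglyMeasurable, ?_⟩
    simp only [HasFiniteIntegral, ← ofReal_norm, Real.norm_eq_abs]
    exact habs.trans_lt ENNReal.ofReal_lt_top
  have hfinp : ∫⁻ x, ENNReal.ofReal (S.indicator q x) ∂lebesgueOn α ≠ ∞ :=
    ne_top_of_le_ne_top ENNReal.ofReal_ne_top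
      ((lintegral_mono fun x => ENNReal.ofReal_le_ofReal (le_abs_self _)).trans habs)
  have hfinn : ∫⁻ x, ENNReal.ofReal (-S.indicator q x) ∂lebesgueOn α ≠ ∞ :=
    ne_top_of_le_ne_top ENNReal.ofReal_ne_top
      ((lintegral_mono fun x => ENNReal.ofReal_le_ofReal (neg_le_abs _)).trans habs)
  refine excess_add_phased_le hle h hq
    (fun x => (hqη x).trans ((min_le_left _ _).trans (min_le_left _ _))) ?_
    (habs.trans (hε1.trans (min_le_right _ _))) ?_ hfinn
  · intro x hx
    have : x ∈ S := by
      by_contra hxS; exact hx (indicator_of_notMem hxS _)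
    exact this.1
  · rw [← ENNReal.toReal_eq_toReal_iff' hfinp hfinn, ← sub_eq_zero,
      ← integral_eq_lintegral_pos_part_sub_lintegral_neg_part hint, integral_indicator hSm, hq0]

open Polynomial in
/-- Centred monomials are linearly independent on sets of positive measure. -/
theorem eq_zero_of_centred_monomials {m : Measure ℝ} [NullSingletonClass m] {k : ℕ} {S : Set ℝ}
    (hS : m S ≠ 0) (a : Fin k → ℝ) (b : Fin k → ℂ)
    (h : ∀ᵐ x ∂m, x ∈ S → ∑ j, b j * ((x ^ ((j : ℕ) + 1) - a j : ℝ) : ℂ) = 0) : b = 0 := by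
  set Q : ℂ[X] := ∑ j : Fin k, C (b j) * (X ^ ((j : ℕ) + 1) - C (a j : ℂ)) with hQ
  have hroot : ∀ x : ℝ, Q.eval (x : ℂ) = ∑ j, b j * ((x ^ ((j : ℕ) + 1) - a j : ℝ) : ℂ) := by
    intro x
    simp [hQ, eval_finsetSum]
  have hQ0 : Q = 0 := by
    by_contra hne
    have hfin : {x : ℝ | Q.eval (x : ℂ) = 0}.Finite := by
      refine Set.Finite.preimage (f := fun x : ℝ => (x : ℂ)) (Complex.ofReal_injective.injOn)
        (s := {z | Q.IsRoot z}) ?_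
      exact Polynomial.finite_setOfPred_isRoot hne
    refine hS (measure_mono_null (t := {x : ℝ | Q.eval (x : ℂ) = 0} ∪
      {x | ¬ (x ∈ S → ∑ j, b j * ((x ^ ((j : ℕ) + 1) - a j : ℝ) : ℂ) = 0)}) ?_
      (measure_union_null (hfin.measure_zero m) h))
    intro x hx
    by_cases hx' : Q.eval (x : ℂ) = 0
    · exact Or.inl hx'
    · exact Or.inr fun hh => hx' (by rw [hroot]; exact hh hx)
  -- Centring only alters the constant coefficient, so `b i` is still the coefficient of `X ^ (i +
  -- 1)`.
  ext i
  have := congrArg (fun p => p.coeff ((i : ℕ) + 1)) hQ0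
  simp only [hQ, finsetSum_coeff, coeff_C_mul, coeff_sub, coeff_X_pow, coeff_C_succ, sub_zero,
    coeff_zero, Nat.add_right_cancel_iff, Fin.val_inj] at this
  simpa using this

/-- Otherwise the centred monomials `x ^ (j + 1) - aⱼ`, suitably scaled and rotated by the phase of
`G`, are `k` independent perturbations contradicting `k`-extremality. -/
theorem measure_eq_zero_of_isKExtreme (hE : E.IsStronglySymmetric) {k : ℕ} {G w : E}
    (hG : IsKExtreme k G) (hw : ‖w‖ ≤ 1) (hle : ∀ c, excess G.1 c ≤ excess w.1 c) {c₁ c₂ : ℝ}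
    {δ : ℝ≥0∞} (hδ : 0 < δ)
    (h : ∀ c : ℝ≥0, c₁ < c → c < c₂ → excess G.1 c + δ ≤ excess w.1 c) :
    lebesgueOn α {x | c₁ < ‖G.1 x‖ ∧ ‖G.1 x‖ < c₂} = 0 := by
  by_contra hpos
  obtain ⟨S, hSm, hSb, hS0, τ, hτ, hS⟩ := exists_perturbations hE hG.1 hw hle hδ h hpos
  have hSfin : lebesgueOn α S ≠ ∞ :=
    ne_top_of_le_ne_top (hSb.measure_lt_top (μ := volume)).ne (Measure.restrict_apply_le _ _)
  obtain ⟨R, hR⟩ := hSb.exists_norm_le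
  have hR' : ∀ x ∈ S, |x| ≤ R := hR
  have hSreal : (lebesgueOn α).real S ≠ 0 := by
    rw [Measure.real, ENNReal.toReal_ne_zero]; exact ⟨hS0, hSfin⟩
  have hintm : ∀ n : ℕ, IntegrableOn (fun x : ℝ => x ^ n) S (lebesgueOn α) := by
    intro n
    refine Measure.integrableOn_of_bounded (M := R ^ n) hSfin (by fun_prop) ?_
    filter_upwards [ae_restrict_mem hSm] with x hx
    rw [norm_pow]
    exact pow_le_pow_left₀ (norm_nonneg _) (hR x hx) n
  set a : Fin k → ℝ := fun j =>
    (∫ x in S, x ^ ((j : ℕ) + 1) ∂lebesgueOn α) / (lebesgueOn α).real S with ha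
  set M : ℝ := ∑ j : Fin k, (R ^ ((j : ℕ) + 1) + |a j|) + 1 with hM
  have hRpos : ∀ x ∈ S, 0 ≤ R := fun x hx => (abs_nonneg x).trans (hR' x hx)
  have hSne : S.Nonempty := nonempty_of_measure_ne_zero hS0
  have hR0 : 0 ≤ R := hRpos _ hSne.choose_spec
  have hMpos : 0 < M := by
    have : 0 ≤ ∑ j : Fin k, (R ^ ((j : ℕ) + 1) + |a j|) :=
      Finset.sum_nonneg fun j _ => by positivity
    linarith
  have hbd : ∀ x ∈ S, ∑ j : Fin k, |x ^ ((j : ℕ) + 1) - a j| ≤ M := by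
    intro x hx
    have : ∑ j : Fin k, |x ^ ((j : ℕ) + 1) - a j| ≤ ∑ j : Fin k, (R ^ ((j : ℕ) + 1) + |a j|) := by
      refine Finset.sum_le_sum fun j _ => (abs_sub _ _).trans ?_
      rw [abs_pow]
      have := pow_le_pow_left₀ (abs_nonneg x) (hR' x hx) ((j : ℕ) + 1)
      linarith
    linarith
  -- `M` bounds the sum over `j`, not just each term, so that `-∑ qⱼ` is an admissible perturbation
  -- as well.
  set θ : ℝ := τ / M with hθ
  have hθpos : 0 < θ := div_pos hτ hMpos
  have hθM : θ * M = τ := div_mul_cancel₀ _ hMpos.ne'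
  set q : Fin k → ℝ → ℝ := fun j x => θ * (x ^ ((j : ℕ) + 1) - a j) with hq
  have hqm : ∀ j, Measurable (q j) := fun j => by fun_prop
  have hqi : ∀ j, IntegrableOn (q j) S (lebesgueOn α) := fun j =>
    ((hintm _).sub (integrableOn_const hSfin)).const_mul θ
  have hq0 : ∀ j, ∫ x in S, q j x ∂lebesgueOn α = 0 := by
    intro j
    simp only [hq]
    rw [integral_const_mul, integral_sub (hintm _) (integrableOn_const hSfin), setIntegral_const,
      smul_eq_mul, ha]
    simp only
    rw [mul_div_cancel₀ _ hSreal, sub_self, mul_zero]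
  have hqb : ∀ x ∈ S, ∑ j, |q j x| ≤ τ := by
    intro x hx
    simp only [hq, abs_mul, ← Finset.mul_sum, abs_of_pos hθpos]
    rw [← hθM]
    exact mul_le_mul_of_nonneg_left (hbd x hx) hθpos.le
  choose hu1 hu2 using fun j => hS (q j) ((hqm j).indicator hSm)
    (fun x hx => (Finset.single_le_sum (f := fun j => |q j x|) (fun _ _ => abs_nonneg _)
      (Finset.mem_univ j)).trans (hqb x hx)) (hq0 j)
  have hqs : Measurable fun x => -∑ j, q j x := (Finset.measurable_sum _ fun j _ => hqm j).neg
  obtain ⟨hv1, hv2⟩ := hS (fun x => -∑ j, q j x) (hqs.indicator hSm)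
    (fun x hx => by rw [abs_neg]; exact (Finset.abs_sum_le_sum_abs _ _).trans (hqb x hx))
    (by rw [integral_neg, integral_finsetSum _ fun j _ => hqi j]; simp [hq0])
  set u : Fin k → E := fun j => ⟨_, hu1 j⟩ with hu
  have hsumcoe : ∀ b : Fin k → ℂ, ((∑ j, b j • u j : E) : L0 α) = ∑ j, b j • (u j : L0 α) := by
    intro b
    simp
  have hsumae : ∀ b : Fin k → ℂ, ((∑ j, b j • u j : E) : L0 α) =ᵐ[lebesgueOn α]
      fun x => phase (G.1 x) * ∑ j, b j * ((S.indicator (q j) x : ℝ) : ℂ) := by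
    intro b
    rw [hsumcoe]
    have hall := ae_all_iff.2 fun j => phased_ae_eq G.1 (S.indicator (q j)) ((hqm j).indicator hSm)
    filter_upwards [coeFn_sum_smul b fun j => (u j : L0 α), hall] with x h1 h2
    rw [h1, Finset.mul_sum]
    refine Finset.sum_congr rfl fun j _ => ?_
    rw [show (u j : L0 α) x = _ from h2 j]
    ring
  have hv : (⟨_, hv1⟩ : E) = -∑ j, u j := by
    refine Subtype.ext (AEEqFun.ext ?_)
    have h1 := hsumae fun _ => -1
    have h2 : ∑ j, (-1 : ℂ) • u j = -∑ j, u j := by simp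
    rw [h2] at h1
    filter_upwards [h1, phased_ae_eq G.1 _ (hqs.indicator hSm)] with x h3 h4
    rw [h3]
    refine h4.trans ?_
    congr 1
    by_cases hx : x ∈ S
    · simp [indicator_of_mem hx]
    · simp [indicator_of_notMem hx]
  rw [hv, ← sub_eq_add_neg] at hv2
  refine hG.false_of_perturbation u ?_ hu2 hv2
  rw [Fintype.linearIndependent_iff]
  intro b hb
  have h1 := hsumae b
  rw [hb] at h1
  have hb0 : b = 0 := by
    refine eq_zero_of_centred_monomials hS0 a b ?_
    filter_upwards [h1, AEEqFun.coeFn_zero (μ := lebesgueOn α) (β := ℂ)] with x h2 h3 hx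
    have h4 : (0 : L0 α) x = phase (G.1 x) * ∑ j, b j * ((S.indicator (q j) x : ℝ) : ℂ) := h2
    rw [h3] at h4
    have h5 := (mul_eq_zero.1 h4.symm).resolve_left (phase_ne_zero _)
    have h6 : ∑ j, b j * ((S.indicator (q j) x : ℝ) : ℂ) =
        θ * ∑ j, b j * ((x ^ ((j : ℕ) + 1) - a j : ℝ) : ℂ) := by
      rw [Finset.mul_sum]
      refine Finset.sum_congr rfl fun j _ => ?_
      rw [indicator_of_mem hx, hq]
      push_cast; ring
    rw [h6] at h5
    exact (mul_eq_zero.1 h5).resolve_left (by exact_mod_cast hθpos.ne')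
  exact fun i => congrFun hb0 i

end Perturbation

/-! ### Where the excess of a `k`-extreme point can be smaller. -/

section Gap

variable {α : ℝ≥0∞}

theorem tsub_le_convex (a : ℝ≥0∞) {s t p q : ℝ≥0} (hst : s + t = 1) :
    a - ((s * p + t * q : ℝ≥0) : ℝ≥0∞) ≤ s * (a - p) + t * (a - q) := by
  have hst' : (s : ℝ≥0∞) + t = 1 := by exact_mod_cast hst
  rw [tsub_le_iff_right]
  calc a = s * a + t * a := by rw [← add_mul, hst', one_mul]
    _ ≤ s * ((a - p) + p) + t * ((a - q) + q) := by gcongr <;> exact le_tsub_add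
    _ = _ := by push_cast; ring

/-- The function `c ↦ (a - c)₊` is affine on every interval without the kink `a` in its interior. -/
theorem tsub_eq_convex {a : ℝ≥0∞} {s t p q : ℝ≥0} (hst : s + t = 1)
    (hpq : p ≤ q) (ha : a ≤ p ∨ q ≤ a) :
    s * (a - p) + t * (a - q) = a - ((s * p + t * q : ℝ≥0) : ℝ≥0∞) := by
  have hst' : (s : ℝ≥0∞) + t = 1 := by exact_mod_cast hst
  rcases ha with ha | ha
  · have hpc : p ≤ s * p + t * q := by
      calc p = s * p + t * p := by rw [← add_mul, hst, one_mul]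
        _ ≤ _ := by gcongr
    rw [tsub_eq_zero_of_le ha, tsub_eq_zero_of_le (ha.trans (ENNReal.coe_le_coe.2 hpq)),
      tsub_eq_zero_of_le (ha.trans (ENNReal.coe_le_coe.2 hpc))]
    simp
  · refine ENNReal.eq_sub_of_add_eq ENNReal.coe_ne_top ?_
    calc _ = s * ((a - p) + p) + t * ((a - q) + q) := by push_cast; ring
      _ = s * a + t * a := by
        rw [tsub_add_cancel_of_le ha, tsub_add_cancel_of_le ((ENNReal.coe_le_coe.2 hpq).trans ha)]
      _ = a := by rw [← add_mul, hst', one_mul]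

theorem lintegral_convex_tsub (f : L0 α) (s t p q : ℝ≥0) :
    ∫⁻ x, (s * (‖f x‖ₑ - p) + t * (‖f x‖ₑ - q)) ∂lebesgueOn α =
      s * excess f p + t * excess f q := by
  have h := measurable_enorm_L0 f
  rw [lintegral_add_left (by fun_prop), lintegral_const_mul _ (by fun_prop),
    lintegral_const_mul _ (by fun_prop)]
  rfl

theorem excess_le_convex (f : L0 α) {s t p q : ℝ≥0} (hst : s + t = 1) :
    excess f (s * p + t * q) ≤ s * excess f p + t * excess f q := by
  rw [← lintegral_convex_tsub]
  exact lintegral_mono fun x => tsub_le_convex _ hst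

theorem excess_eq_convex {f : L0 α} {s t p q : ℝ≥0} (hst : s + t = 1) (hpq : p ≤ q)
    (hf : ∀ᵐ x ∂lebesgueOn α, ‖f x‖ₑ ≤ p ∨ q ≤ ‖f x‖ₑ) :
    s * excess f p + t * excess f q = excess f (s * p + t * q) := by
  rw [← lintegral_convex_tsub]
  refine lintegral_congr_ae ?_
  filter_upwards [hf] with x hx using tsub_eq_convex hst hpq hx

theorem exists_gt_lt_excess (f : L0 α) {T : ℝ≥0∞} {c : ℝ≥0} (h : T < excess f c) :
    ∃ c', c < c' ∧ T < excess f c' := by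
  obtain ⟨u, hu, hlt, hlim⟩ := exists_seq_strictAnti_tendsto c
  have hm := measurable_enorm_L0 f
  have : Tendsto (fun n => excess f (u n)) atTop (𝓝 (excess f c)) := by
    refine lintegral_tendsto_of_tendsto_of_monotone (fun n => by fun_prop) ?_ ?_
    · exact ae_of_all _ fun x a b hab =>
        tsub_le_tsub_left (ENNReal.coe_le_coe.2 (hu.antitone hab)) _
    · exact ae_of_all _ fun x => ENNReal.Tendsto.sub tendsto_const_nhds
        (ENNReal.tendsto_coe.2 hlim) (Or.inl enorm_ne_top)
  obtain ⟨n, hn⟩ := ((tendsto_order.1 this).1 T h).exists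
  exact ⟨u n, hlt n, hn⟩

/-- A strict inequality at `c` spreads to a neighbourhood with a uniform gap: to the right by
right-continuity of the excess of `w`, to the left by convexity of the excess of `f`. -/
theorem exists_nhds_excess_add_le {f w : L0 α} (hle : ∀ c, excess f c ≤ excess w c) {c : ℝ≥0}
    (h : excess f c < excess w c) : ∃ c₁ c₂ : ℝ, c₁ < c ∧ c < c₂ ∧ ∃ δ : ℝ≥0∞, 0 < δ ∧
      ∀ c' : ℝ≥0, c₁ < c' → c' < c₂ → excess f c' + δ ≤ excess w c' := by
  obtain ⟨r, hr, hfr⟩ := ENNReal.lt_iff_exists_add_pos_lt.1 h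
  obtain ⟨c₂, hc₂, hw⟩ := exists_gt_lt_excess w hfr
  have hleft : ∃ c₁ : ℝ, c₁ < c ∧ ∀ c' : ℝ≥0, c₁ < c' → c' < c →
      excess f c' + ((r / 2 : ℝ≥0) : ℝ≥0∞) ≤ excess w c' := by
    by_cases hp : ∃ p < c, excess f p ≠ ∞
    -- Between `s p + (1 - s) c` and `c`, convexity keeps the excess of `f` below its value at `c`
    -- plus `s * P ≤ r / 2`.
    · obtain ⟨p, hpc, hp⟩ := hp
      lift excess f p to ℝ≥0 using hp with P hP
      obtain ⟨s, hs0, hs1, hsP⟩ : ∃ s : ℝ≥0, 0 < s ∧ s ≤ 1 ∧ s * P ≤ r / 2 := by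
        refine ⟨min 1 (r / 2 / (P + 1)), lt_min one_pos (by positivity), min_le_left _ _, ?_⟩
        calc min 1 (r / 2 / (P + 1)) * P ≤ r / 2 / (P + 1) * (P + 1) := by
              gcongr
              · exact min_le_right _ _
              · simp
          _ = r / 2 := div_mul_cancel₀ _ (by positivity)
      have hst : s + (1 - s) = 1 := add_tsub_cancel_of_le hs1
      refine ⟨((s * p + (1 - s) * c : ℝ≥0) : ℝ), ?_, fun c' h1 h2 => ?_⟩
      · rw [NNReal.coe_lt_coe]
        calc s * p + (1 - s) * c < s * c + (1 - s) * c := by gcongr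
          _ = c := by rw [← add_mul, hst, one_mul]
      · have h1' : s * p + (1 - s) * c < c' := NNReal.coe_lt_coe.1 h1
        have h2' : c' < c := NNReal.coe_lt_coe.1 h2
        calc excess f c' + ((r / 2 : ℝ≥0) : ℝ≥0∞)
            ≤ (s * excess f p + ((1 - s : ℝ≥0) : ℝ≥0∞) * excess f c) +
              ((r / 2 : ℝ≥0) : ℝ≥0∞) := by
              gcongr
              exact (excess_antitone f h1'.le).trans (excess_le_convex f hst)
          _ ≤ (((r / 2 : ℝ≥0) : ℝ≥0∞) + 1 * excess f c) + ((r / 2 : ℝ≥0) : ℝ≥0∞) := by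
              gcongr
              · rw [← hP, ← ENNReal.coe_mul]; exact ENNReal.coe_le_coe.2 hsP
              · exact_mod_cast tsub_le_self
          _ = excess f c + ((r / 2 + r / 2 : ℝ≥0) : ℝ≥0∞) := by
              rw [one_mul, ENNReal.coe_add]; ring
          _ ≤ excess w c := by rw [add_halves]; exact hfr.le
          _ ≤ excess w c' := excess_antitone w h2'.le
    -- Here the excess of `f`, hence that of `w`, is infinite everywhere to the left of `c`.
    · push Not at hp
      refine ⟨c - 1, by linarith, fun c' _ h2 => ?_⟩
      have := hle c'
      rw [hp c' (NNReal.coe_lt_coe.1 h2), top_le_iff] at this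
      rw [this]; exact le_top
  obtain ⟨c₁, hc₁, hl⟩ := hleft
  refine ⟨c₁, c₂, hc₁, NNReal.coe_lt_coe.2 hc₂, ((r / 2 : ℝ≥0) : ℝ≥0∞), by
    exact_mod_cast half_pos hr, fun c' h1 h2 => ?_⟩
  rcases lt_or_ge c' c with h3 | h3
  · exact hl c' h1 h3
  · calc excess f c' + ((r / 2 : ℝ≥0) : ℝ≥0∞) ≤ excess f c + r := by
          gcongr
          · exact excess_antitone f h3
          · exact_mod_cast half_le_self hr.le
      _ ≤ excess w c₂ := hw.le
      _ ≤ excess w c' := excess_antitone w (NNReal.coe_lt_coe.1 h2).le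

/-- If `f` takes no values near the points where the excess of `f` is strictly smaller than that
of `w`, then there are no such points. -/
theorem excess_eq_of_no_mass {f w : L0 α} (hle : ∀ c, excess f c ≤ excess w c)
    (h : ∀ (c₁ c₂ : ℝ) (δ : ℝ≥0∞), 0 < δ →
      (∀ c : ℝ≥0, c₁ < c → c < c₂ → excess f c + δ ≤ excess w c) →
      lebesgueOn α {x | c₁ < ‖f x‖ ∧ ‖f x‖ < c₂} = 0) (c : ℝ≥0) : excess f c = excess w c := by
  refine le_antisymm (hle c) ?_
  by_contra! hc
  -- On the support of the law of `|f|` the excesses agree, so `c` lies off the support; `p` and `q`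
  -- are the nearest support points on either side.
  set ν := (lebesgueOn α).map fun x => ‖f x‖ with hν
  have hfm : Measurable fun x => ‖f x‖ := f.measurable.norm
  have hK : ∀ a : ℝ≥0, (a : ℝ) ∈ ν.support → excess w a ≤ excess f a := by
    intro a ha
    by_contra! hlt
    obtain ⟨c₁, c₂, h1, h2, δ, hδ, hh⟩ := exists_nhds_excess_add_le hle hlt
    have hpos := (Measure.mem_support_iff_forall _).1 ha (Ioo c₁ c₂) (Ioo_mem_nhds h1 h2)
    rw [hν, Measure.map_apply hfm measurableSet_Ioo] at hpos
    exact hpos.ne' (h c₁ c₂ δ hδ hh)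
  have hcK : (c : ℝ) ∉ ν.support := fun hh => absurd (hK c hh) (not_le.2 hc)
  have hae : ∀ᵐ x ∂lebesgueOn α, ‖f x‖ ∈ ν.support :=
    ae_of_ae_map hfm.aemeasurable Measure.support_mem_ae
  have hclosed : IsClosed ν.support := Measure.isClosed_support
  have hlow : (∃ p : ℝ≥0, p < c ∧ (p : ℝ) ∈ ν.support ∧
      ∀ᵐ x ∂lebesgueOn α, ‖f x‖ < c → ‖f x‖ₑ ≤ p) ∨ ∀ᵐ x ∂lebesgueOn α, (c : ℝ) ≤ ‖f x‖ := by
    rcases (ν.support ∩ Icc 0 (c : ℝ)).eq_empty_or_nonempty with he | hne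
    · right
      filter_upwards [hae] with x hx
      by_contra! hlt
      exact absurd (show ‖f x‖ ∈ ν.support ∩ Icc 0 (c : ℝ) from ⟨hx, norm_nonneg _, hlt.le⟩)
        (by rw [he]; exact notMem_empty _)
    · left
      obtain ⟨p, ⟨hp1, hp2⟩, hp3⟩ := (isCompact_Icc.inter_left hclosed).exists_isGreatest hne
      lift p to ℝ≥0 using hp2.1
      refine ⟨p, lt_of_le_of_ne (NNReal.coe_le_coe.1 hp2.2) ?_, hp1, ?_⟩
      · rintro rfl; exact hcK hp1
      · filter_upwards [hae] with x hx hlt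
        rw [enorm_le_coe]
        exact hp3 ⟨hx, norm_nonneg _, hlt.le⟩
  have hhigh : (∃ q : ℝ≥0, c < q ∧ (q : ℝ) ∈ ν.support ∧
      ∀ᵐ x ∂lebesgueOn α, c ≤ ‖f x‖ → q ≤ ‖f x‖ₑ) ∨ ∀ᵐ x ∂lebesgueOn α, ‖f x‖ < c := by
    rcases (ν.support ∩ Ici (c : ℝ)).eq_empty_or_nonempty with he | hne
    · right
      filter_upwards [hae] with x hx
      by_contra! hlt
      exact absurd (show ‖f x‖ ∈ ν.support ∩ Ici (c : ℝ) from ⟨hx, hlt⟩)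
        (by rw [he]; exact notMem_empty _)
    · left
      have hbd : BddBelow (ν.support ∩ Ici (c : ℝ)) := ⟨c, fun x hx => hx.2⟩
      obtain ⟨hq1, hq2⟩ := (hclosed.inter isClosed_Ici).csInf_mem hne hbd
      obtain ⟨q, hq⟩ : ∃ q : ℝ≥0, (q : ℝ) = sInf (ν.support ∩ Ici (c : ℝ)) :=
        ⟨⟨_, c.coe_nonneg.trans hq2⟩, rfl⟩
      rw [← hq] at hq1 hq2
      refine ⟨q, lt_of_le_of_ne (NNReal.coe_le_coe.1 hq2) ?_, hq1, ?_⟩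
      · rintro rfl; exact hcK hq1
      · filter_upwards [hae] with x hx hlt
        rw [enorm_eq_nnnorm, ENNReal.coe_le_coe, ← NNReal.coe_le_coe, hq]
        exact csInf_le hbd ⟨hx, hlt⟩
  -- With `p` and `q`: affine against convex. With only `p`: `|f| ≤ p`, so both excesses vanish
  -- beyond `p`. With only `q`: `|f| ≥ q`, and the excess of `f` has the steepest possible slope
  -- `-m[0, α)` on `[c, q]`. With neither, the measure is zero.
  rcases hlow with ⟨p, hpc, hpK, hp⟩ | hlow <;> rcases hhigh with ⟨q, hcq, hqK, hq⟩ | hhigh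
  · have hpq : p < q := hpc.trans hcq
    have hqp : q - p ≠ 0 := (tsub_pos_of_lt hpq).ne'
    obtain ⟨s, t, hst, hc'⟩ : ∃ s t : ℝ≥0, s + t = 1 ∧ s * p + t * q = c := by
      refine ⟨(q - c) / (q - p), (c - p) / (q - p), ?_, ?_⟩
      · rw [← add_div, tsub_add_tsub_cancel hcq.le hpc.le, div_self hqp]
      · rw [div_mul_eq_mul_div, div_mul_eq_mul_div, ← add_div, div_eq_iff hqp]
        rw [← NNReal.coe_inj]
        push_cast [hcq.le, hpc.le, hpq.le]
        ring
    have hgap : ∀ᵐ x ∂lebesgueOn α, ‖f x‖ₑ ≤ p ∨ q ≤ ‖f x‖ₑ := by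
      filter_upwards [hp, hq] with x h1 h2
      rcases lt_or_ge ‖f x‖ c with h3 | h3
      · exact Or.inl (h1 h3)
      · exact Or.inr (h2 h3)
    refine absurd hc (not_lt.2 ?_)
    rw [← hc', ← excess_eq_convex hst hpq.le hgap]
    refine (excess_le_convex w hst).trans ?_
    gcongr
    · exact hK p hpK
    · exact hK q hqK
  · have h0 : excess f p = 0 := by
      refine (lintegral_congr_ae ?_).trans lintegral_zero
      filter_upwards [hp, hhigh] with x h1 h2
      exact tsub_eq_zero_of_le (h1 h2)
    have h1 := (excess_antitone w hpc.le).trans (hK p hpK)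
    rw [h0] at h1
    exact absurd (hc.trans_le h1) not_lt_zero
  · have h1 : excess w c ≤ excess w q + ((q - c : ℝ≥0) : ℝ≥0∞) * lebesgueOn α univ := by
      rw [← lintegral_const, excess, excess, ← lintegral_add_right _ measurable_const]
      refine lintegral_mono fun x => ?_
      rw [ENNReal.coe_sub]
      exact tsub_le_tsub_add_tsub
    have h2 : excess f c = excess f q + ((q - c : ℝ≥0) : ℝ≥0∞) * lebesgueOn α univ := by
      rw [← lintegral_const, excess, excess, ← lintegral_add_right _ measurable_const]
      refine lintegral_congr_ae ?_
      filter_upwards [hlow, hq] with x h3 h4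
      rw [ENNReal.coe_sub, tsub_add_tsub_cancel (h4 h3) (ENNReal.coe_le_coe.2 hcq.le)]
    refine absurd hc (not_lt.2 (h1.trans ?_))
    rw [h2]
    gcongr
    exact hK q hqK
  · have h0 : excess w c = 0 := by
      refine (lintegral_congr_ae ?_).trans lintegral_zero
      filter_upwards [hlow, hhigh] with x h1 h2
      exact absurd h2 (not_lt.2 h1)
    rw [h0] at hc
    exact absurd hc not_lt_zero

variable {E : NormedFunctionSpace α}

theorem excess_eq_of_isKExtreme (hE : E.IsStronglySymmetric) {k : ℕ} {G w : E}
    (hG : IsKExtreme k G) (hw : ‖w‖ ≤ 1) (hle : ∀ c, excess G.1 c ≤ excess w.1 c) (c : ℝ≥0) :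
    excess G.1 c = excess w.1 c :=
  excess_eq_of_no_mass hle
    (fun _ _ _ hδ h => measure_eq_zero_of_isKExtreme hE hG hw hle hδ h) c

theorem rearrAtInfty_ne_top (hE : E.IsStronglySymmetric) (g : E) : rearrAtInfty g.1 ≠ ∞ :=
  ne_top_of_le_ne_top (rearr_ne_top hE g 1 one_pos) (iInf_le _ 1)

theorem distribution_eq_top {f : L0 α} {s : ℝ≥0} (h : s < rearrAtInfty f) :
    distribution f s = ∞ := by
  refine ENNReal.eq_top_of_forall_nnreal_le fun r => ?_
  have : (s : ℝ≥0∞) < rearr f r := h.trans_le (iInf_le _ _)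
  rw [← rearrE_ofReal, coe_lt_rearrE_iff, ENNReal.ofReal_coe_nnreal] at this
  exact this.le

theorem distribution_lt_top {f : L0 α} {s : ℝ≥0} (h : rearrAtInfty f < s) :
    distribution f s < ∞ := by
  obtain ⟨t, ht⟩ := iInf_lt_iff.1 h
  exact ((rearrE_le_iff f _ s).1 ht.le).trans_lt ENNReal.ofReal_lt_top

theorem excess_eq_top {f : L0 α} {c : ℝ≥0} (h : c < rearrAtInfty f) : excess f c = ∞ := by
  obtain ⟨s, hcs, hs⟩ := ENNReal.lt_iff_exists_nnreal_btwn.1 h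
  have hd := distribution_eq_top hs
  rw [distribution_eq] at hd
  have hm := measurable_enorm_L0 f
  have hmark := mul_meas_ge_le_lintegral (μ := lebesgueOn α) (f := fun x => ‖f x‖ₑ - c)
    (by fun_prop) ((s : ℝ≥0∞) - c)
  refine top_le_iff.1 (le_trans ?_ hmark)
  have hset : lebesgueOn α {x | (s : ℝ≥0∞) - c ≤ ‖f x‖ₑ - c} = ∞ := by
    refine top_le_iff.1 ?_
    rw [← hd]
    exact measure_mono fun x (hx : (s : ℝ≥0∞) < ‖f x‖ₑ) => tsub_le_tsub_right hx.le _
  rw [hset, ENNReal.mul_top (tsub_pos_of_lt hcs).ne']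

theorem rearrAtInfty_le_of_isKExtreme (hE : E.IsStronglySymmetric) {k : ℕ} {f : E}
    (hf : IsKExtreme k f) :
    ∀ᵐ t ∂lebesgueOn α, rearrAtInfty f.1 ≤ ENNReal.ofReal ‖f.1 t‖ := by
  have htop := rearrAtInfty_ne_top hE f
  -- The excess is infinite below `μ(∞, f)`, so there it exceeds itself by `1`. The choice `c₁ = -1`
  -- puts the value `0` in the window.
  have h := measure_eq_zero_of_isKExtreme hE hf hf.1.le (fun _ => le_rfl) (c₁ := -1)
    (c₂ := (rearrAtInfty f.1).toReal) one_pos (fun c _ hc => by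
      rw [excess_eq_top]
      · simp
      · rw [← ENNReal.ofReal_coe_nnreal]
        exact (ENNReal.ofReal_lt_iff_lt_toReal c.coe_nonneg htop).2 hc)
  filter_upwards [measure_eq_zero_iff_ae_notMem.1 h] with x hx
  by_contra! hlt
  refine hx ⟨by linarith [norm_nonneg (f.1 x)], ?_⟩
  exact (ENNReal.ofReal_lt_iff_lt_toReal (norm_nonneg _) htop).1 hlt

end Gap

/-! ### Averages against averages of rearrangements. -/

section Average

variable {α : ℝ≥0∞} {E : NormedFunctionSpace α} {k : ℕ}

/-- The average of the rearrangements of finitely many functions. -/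
noncomputable def avgRearr (F : Fin (k + 1) → E) (t : ℝ) : ℝ≥0∞ :=
  ((k + 1 : ℕ) : ℝ≥0∞)⁻¹ * ∑ i, rearr (F i).1 t

theorem card_ne_zero (k : ℕ) : ((k + 1 : ℕ) : ℝ≥0∞) ≠ 0 := by exact_mod_cast Nat.succ_ne_zero k

theorem card_ne_top (k : ℕ) : ((k + 1 : ℕ) : ℝ≥0∞) ≠ ∞ := ENNReal.natCast_ne_top _

theorem lintegral_avgRearr (F : Fin (k + 1) → E) (m : Measure ℝ) :
    ∫⁻ t, avgRearr F t ∂m = ((k + 1 : ℕ) : ℝ≥0∞)⁻¹ * ∑ i, ∫⁻ t, rearr (F i).1 t ∂m := by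
  have hm : ∀ i, Measurable (rearr (F i).1) := fun i => measurable_rearr _
  unfold avgRearr
  rw [lintegral_const_mul _ (by fun_prop), lintegral_finsetSum _ fun i _ => hm i]

theorem exists_avg_rearrL0 (hE : E.IsStronglySymmetric) (F : Fin (k + 1) → E)
    (hF : ∀ i, ‖F i‖ = 1) : ∃ w : E, ‖w‖ ≤ 1 ∧ ∀ c, excess w.1 c =
      ∫⁻ s in Ioi 0, (avgRearr F s - c) := by
  choose hmem hnorm using fun i => rearrL0_mem hE (F i)
  have hk : (0 : ℝ) < k + 1 := by positivity
  refine ⟨(1 / ((k : ℂ) + 1)) • ∑ i, ⟨rearrL0 (F i).1, hmem i⟩, ?_, fun c => ?_⟩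
  · rw [norm_smul]
    have h1 : ‖(1 / ((k : ℂ) + 1))‖ = 1 / ((k : ℝ) + 1) := by
      rw [norm_div, norm_one]
      congr 1
      have : ((k : ℂ) + 1) = (((k : ℝ) + 1 : ℝ) : ℂ) := by push_cast; rfl
      rw [this, Complex.norm_real, Real.norm_of_nonneg hk.le]
    have h2 : ‖∑ i, (⟨rearrL0 (F i).1, hmem i⟩ : E)‖ ≤ (k : ℝ) + 1 := by
      refine (norm_sum_le _ _).trans ((Finset.sum_le_sum fun i _ =>
        (hnorm i).trans (hF i).le).trans ?_)
      simp
    rw [h1, one_div, inv_mul_le_iff₀ hk, mul_one]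
    exact h2
  · rw [← lintegral_lebesgueOn_eq (α := α) (fun t => avgRearr F t - c)
      (fun t ht => by simp [avgRearr, rearr_eq_zero ht])]
    refine lintegral_congr_ae ?_
    have hcoe : (((1 / ((k : ℂ) + 1)) • ∑ i, (⟨rearrL0 (F i).1, hmem i⟩ : E) : E) : L0 α) =
        ∑ i, (1 / ((k : ℂ) + 1)) • rearrL0 (F i).1 := by
      simp [Finset.smul_sum]
    have hall := ae_all_iff.2 fun i => rearrL0_ae_eq (F i).1
    rw [hcoe]
    filter_upwards [coeFn_sum_smul (fun _ : Fin (k + 1) => 1 / ((k : ℂ) + 1))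
      fun i => rearrL0 (F i).1, hall, ae_lebesgueOn_pos α] with t h1 h2 h3
    have h4 : ∑ i, 1 / ((k : ℂ) + 1) * rearrL0 (F i).1 t =
        (((((k : ℝ) + 1)⁻¹ * ∑ i, (rearr (F i).1 t).toReal : ℝ)) : ℂ) := by
      push_cast
      rw [Finset.mul_sum]
      exact Finset.sum_congr rfl fun i _ => by rw [h2 i, one_div]
    have h5 : (0 : ℝ) ≤ ∑ i, (rearr (F i).1 t).toReal :=
      Finset.sum_nonneg fun i _ => ENNReal.toReal_nonneg
    rw [h1, h4, ← ofReal_norm, Complex.norm_real, Real.norm_of_nonneg (by positivity),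
      ENNReal.ofReal_mul (by positivity), ENNReal.ofReal_inv_of_pos hk,
      ← ENNReal.toReal_sum (fun i _ => rearr_ne_top hE (F i) t h3), ENNReal.ofReal_toReal
        (ENNReal.sum_ne_top.2 fun i _ => rearr_ne_top hE (F i) t h3), avgRearr]
    congr 3
    rw [← Nat.cast_succ, ENNReal.ofReal_natCast]

variable {F : L0 α} {Fi : Fin (k + 1) → E}

theorem avg_ae_eq (hF : F = (1 / ((k : ℂ) + 1)) • ∑ i, (Fi i : L0 α)) :
    ∀ᵐ x ∂lebesgueOn α, ((k : ℂ) + 1) * F x = ∑ i, (Fi i : L0 α) x := by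
  have hk : (k : ℂ) + 1 ≠ 0 := by exact_mod_cast Nat.succ_ne_zero k
  rw [Finset.smul_sum] at hF
  filter_upwards [coeFn_sum_smul (fun _ : Fin (k + 1) => 1 / ((k : ℂ) + 1))
    fun i => (Fi i : L0 α)] with x hx
  rw [hF, hx, ← Finset.mul_sum, ← mul_assoc, mul_one_div_cancel hk, one_mul]

theorem setLIntegral_avg_le (hF : F = (1 / ((k : ℂ) + 1)) • ∑ i, (Fi i : L0 α)) (A : Set ℝ) :
    ∫⁻ x in A, ‖F x‖ₑ ∂lebesgueOn α ≤
      ((k + 1 : ℕ) : ℝ≥0∞)⁻¹ * ∑ i, ∫⁻ x in A, ‖(Fi i : L0 α) x‖ₑ ∂lebesgueOn α := by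
  have hm : ∀ i, Measurable fun x => ‖(Fi i : L0 α) x‖ₑ := fun i => measurable_enorm_L0 _
  rw [← lintegral_finsetSum _ fun i _ => hm i, ← lintegral_const_mul _ (by fun_prop)]
  refine lintegral_mono_ae (ae_restrict_of_ae ?_)
  filter_upwards [avg_ae_eq hF] with x hx
  rw [← ENNReal.div_eq_inv_mul, ENNReal.le_div_iff_mul_le (Or.inl (card_ne_zero k))
    (Or.inl (card_ne_top k)), mul_comm]
  have h1 : ((k + 1 : ℕ) : ℝ≥0∞) = ‖((k : ℂ) + 1)‖ₑ := by
    rw [← Nat.cast_succ, ← ofReal_norm, Complex.norm_natCast, ENNReal.ofReal_natCast]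
  rw [h1, ← enorm_mul, hx]
  exact enorm_sum_le _ _

theorem sum_setLIntegral_le (hE : E.IsStronglySymmetric) {A : Set ℝ} {t : ℝ} (ht : 0 ≤ t)
    (hA : lebesgueOn α A ≤ ENNReal.ofReal t) :
    ((k + 1 : ℕ) : ℝ≥0∞)⁻¹ * ∑ i, ∫⁻ x in A, ‖(Fi i : L0 α) x‖ₑ ∂lebesgueOn α ≤
      ∫⁻ s in Ioo 0 t, avgRearr Fi s := by
  rw [lintegral_avgRearr]
  exact mul_le_mul' le_rfl (Finset.sum_le_sum fun i _ =>
    setLIntegral_enorm_le_rearr (rearr_ne_top hE (Fi i)) ht hA)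

theorem setLIntegral_enorm_eq {A : Set ℝ} (hAm : MeasurableSet A) {c : ℝ≥0}
    (h : ∀ x ∈ A, c ≤ ‖F x‖ₑ) : ∫⁻ x in A, ‖F x‖ₑ ∂lebesgueOn α =
      c * lebesgueOn α A + ∫⁻ x in A, (‖F x‖ₑ - c) ∂lebesgueOn α := by
  rw [← setLIntegral_const, ← lintegral_add_left measurable_const]
  exact setLIntegral_congr_fun hAm fun x hx => (add_tsub_cancel_of_le (h x hx)).symm

/-- This is the triangle inequality for rearrangements. On a finite-measure part `A` of `{|F| ≥ c}`,
the sum `c m(A) + ∫_A (|F| - c)` equals `∫_A |F|`, which is at most the integral of the averaged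
rearrangements over `(0, m(A))`; then `c m(A)` cancels. -/
theorem excess_avg_le (hE : E.IsStronglySymmetric)
    (hF : F = (1 / ((k : ℂ) + 1)) • ∑ i, (Fi i : L0 α)) (c : ℝ≥0) :
    excess F c ≤ ∫⁻ s in Ioi 0, (avgRearr Fi s - c) := by
  refine lintegral_le_of_forall_fin_meas_le _ fun S hS hSfin => ?_
  set A := S ∩ {x | (c : ℝ≥0∞) ≤ ‖F x‖ₑ} with hA
  have hAm : MeasurableSet A := hS.inter (measurableSet_le measurable_const (measurable_enorm_L0 F))
  have hAfin : lebesgueOn α A ≠ ∞ := ne_top_of_le_ne_top hSfin (measure_mono inter_subset_left)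
  have h1 : ∫⁻ x in S, (‖F x‖ₑ - c) ∂lebesgueOn α = ∫⁻ x in A, (‖F x‖ₑ - c) ∂lebesgueOn α := by
    rw [← lintegral_indicator hS, ← lintegral_indicator hAm]
    congr 1
    ext x
    by_cases hx : x ∈ S
    · by_cases hx' : (c : ℝ≥0∞) ≤ ‖F x‖ₑ
      · rw [indicator_of_mem hx, indicator_of_mem (show x ∈ A from ⟨hx, hx'⟩)]
      · rw [indicator_of_mem hx, indicator_of_notMem (fun hh : x ∈ A => hx' hh.2)]
        exact tsub_eq_zero_of_le (not_le.1 hx').le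
    · rw [indicator_of_notMem hx, indicator_of_notMem (fun hh : x ∈ A => hx hh.1)]
  rw [h1]
  have hof : ENNReal.ofReal (lebesgueOn α A).toReal = lebesgueOn α A := ENNReal.ofReal_toReal hAfin
  have h2 := (setLIntegral_avg_le hF A).trans
    ((sum_setLIntegral_le hE ENNReal.toReal_nonneg hof.ge).trans (lintegral_Ioo_le _ c _))
  rw [setLIntegral_enorm_eq hAm fun x hx => hx.2, hof] at h2
  exact (ENNReal.add_le_add_iff_left (ENNReal.mul_ne_top ENNReal.coe_ne_top hAfin)).1 h2

theorem lintegral_avgRearr_ne_top (hE : E.IsStronglySymmetric) (t : ℝ) :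
    ∫⁻ s in Ioo 0 t, avgRearr Fi s ≠ ∞ := by
  rw [lintegral_avgRearr]
  exact ENNReal.mul_ne_top (ENNReal.inv_ne_top.2 (card_ne_zero k))
    (ENNReal.sum_ne_top.2 fun i _ => lintegral_rearr_ne_top hE (Fi i) t)

theorem continuousWithinAt_avgRearr (t : ℝ) : ContinuousWithinAt (avgRearr Fi) (Ici t) t :=
  ENNReal.Tendsto.const_mul (tendsto_finsetSum _ fun i _ => continuousWithinAt_rearr (Fi i).1 t)
    (Or.inr (ENNReal.inv_ne_top.2 (card_ne_zero k)))

/-- If the rearrangement of an average is the average of the rearrangements, then the superlevel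
sets of the average are superlevel sets of all the terms. -/
theorem superlevel_of_excess_eq (hE : E.IsStronglySymmetric)
    (hF : F = (1 / ((k : ℂ) + 1)) • ∑ i, (Fi i : L0 α))
    (hex : ∀ c, excess F c = ∫⁻ s in Ioi 0, (avgRearr Fi s - c)) {s : ℝ≥0}
    (hs : distribution F s ≠ ∞) :
    avgRearr Fi (distribution F s).toReal ≤ s ∧
      ∀ i, ∀ᵐ x ∂lebesgueOn α, ‖F x‖ₑ ≤ s →
        ‖(Fi i : L0 α) x‖ₑ ≤ rearr (Fi i).1 (distribution F s).toReal := by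
  set t := (distribution F s).toReal with ht
  set A := {x | (s : ℝ≥0∞) < ‖F x‖ₑ} with hA
  have hAm : MeasurableSet A := measurableSet_lt measurable_const (measurable_enorm_L0 F)
  have ht0 : 0 ≤ t := ENNReal.toReal_nonneg
  have hAt : lebesgueOn α A = ENNReal.ofReal t := by
    rw [ht, ENNReal.ofReal_toReal hs, distribution_eq]
  have hWtop : ∫⁻ s in Ioo 0 t, avgRearr Fi s ≠ ∞ := lintegral_avgRearr_ne_top hE t
  have hexA : ∫⁻ x in A, (‖F x‖ₑ - s) ∂lebesgueOn α = excess F s := by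
    rw [excess, ← lintegral_indicator hAm]
    congr 1
    ext x
    by_cases hx : x ∈ A
    · rw [indicator_of_mem hx]
    · rw [indicator_of_notMem hx]
      exact (tsub_eq_zero_of_le (not_lt.1 hx)).symm
  -- The estimates `h1` to `h4` form a cycle starting and ending at `s t` plus the excess, so all of
  -- them are equalities.
  have h1 : ∫⁻ x in A, ‖F x‖ₑ ∂lebesgueOn α = s * ENNReal.ofReal t + excess F s := by
    rw [setLIntegral_enorm_eq hAm fun x hx => le_of_lt hx, hexA, hAt]
  have h2 := setLIntegral_avg_le hF A
  have h3 := sum_setLIntegral_le (Fi := Fi) hE ht0 hAt.le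
  have h4 : ∫⁻ s in Ioo 0 t, avgRearr Fi s ≤ s * ENNReal.ofReal t + excess F s := by
    rw [hex]; exact lintegral_Ioo_le _ s t
  have hexfin : excess F s ≠ ∞ := by
    refine ne_top_of_le_ne_top hWtop (le_trans ?_ (h2.trans h3))
    rw [h1]; exact le_add_self
  constructor
  · have h5 : ∫⁻ x in Ioi 0, (avgRearr Fi x - s) ≤ ∫⁻ x in Ioo 0 t, (avgRearr Fi x - s) := by
      have h6 : s * ENNReal.ofReal t + excess F s ≤
          s * ENNReal.ofReal t + ∫⁻ x in Ioo 0 t, (avgRearr Fi x - s) := by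
        rw [← h1]
        refine (h2.trans h3).trans ?_
        calc ∫⁻ x in Ioo 0 t, avgRearr Fi x ≤ ∫⁻ x in Ioo 0 t, (s + (avgRearr Fi x - s)) :=
              lintegral_mono fun x => le_add_tsub
          _ = _ := by
              rw [lintegral_add_left measurable_const, setLIntegral_const, Real.volume_Ioo,
                sub_zero]
      rw [← hex]
      exact (ENNReal.add_le_add_iff_left
        (ENNReal.mul_ne_top ENNReal.coe_ne_top ENNReal.ofReal_ne_top)).1 h6
    have hm : Measurable (avgRearr Fi) := by
      have hm : ∀ i, Measurable (rearr (Fi i).1) := fun i => measurable_rearr _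
      unfold avgRearr
      fun_prop
    have h7 : ∫⁻ x in Ioi t, (avgRearr Fi x - s) = 0 := by
      have h8 : (∫⁻ x in Ioo 0 t, (avgRearr Fi x - s)) + ∫⁻ x in Ioi t, (avgRearr Fi x - s) ≤
          ∫⁻ x in Ioo 0 t, (avgRearr Fi x - s) := by
        rw [← lintegral_union measurableSet_Ioi
          (Set.disjoint_left.2 fun x hx hx' => lt_asymm hx.2 hx')]
        refine le_trans (lintegral_mono_set ?_) h5
        rintro x (hx | hx)
        · exact hx.1
        · exact ht0.trans_lt hx
      have h9 : ∫⁻ x in Ioo 0 t, (avgRearr Fi x - s) ≠ ∞ :=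
        ne_top_of_le_ne_top hWtop (lintegral_mono fun x => tsub_le_self)
      exact nonpos_iff_eq_zero.1 ((ENNReal.add_le_add_iff_left h9).1 (by simpa using h8))
    by_contra! hlt
    -- The vanishing integral controls almost every point beyond `t`; right-continuity reaches `t`
    -- itself.
    have hev : ∀ᶠ x in 𝓝[>] t, (s : ℝ≥0∞) < avgRearr Fi x :=
      ((tendsto_order.1 (continuousWithinAt_avgRearr (Fi := Fi) t)).1 _ hlt).filter_mono
        (nhdsWithin_mono _ Ioi_subset_Ici_self)
    obtain ⟨u, hu, hsub⟩ := mem_nhdsGT_iff_exists_Ioo_subset.1 hev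
    rw [lintegral_eq_zero_iff (by fun_prop), EventuallyEq,
      ae_restrict_iff' measurableSet_Ioi] at h7
    have hnull : volume (Ioo t u) = 0 := by
      refine measure_mono_null (fun x hx => ?_) h7
      intro hh
      exact absurd (tsub_eq_zero_iff_le.1 (hh hx.1)) (not_le.2 (hsub hx))
    rw [Real.volume_Ioo, ENNReal.ofReal_eq_zero] at hnull
    linarith [show t < u from hu]
  · intro i
    have hle : ∀ j, ∫⁻ x in A, ‖(Fi j : L0 α) x‖ₑ ∂lebesgueOn α ≤
        ∫⁻ s in Ioo 0 t, rearr (Fi j).1 s := fun j =>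
      setLIntegral_enorm_le_rearr (rearr_ne_top hE (Fi j)) ht0 hAt.le
    -- Each term satisfies the Hardy–Littlewood bound and the sums agree, so every term attains it.
    have hsum : ∑ j, ∫⁻ s in Ioo 0 t, rearr (Fi j).1 s ≤
        ∑ j, ∫⁻ x in A, ‖(Fi j : L0 α) x‖ₑ ∂lebesgueOn α := by
      have h5 := h4.trans (h1.ge.trans h2)
      rw [lintegral_avgRearr] at h5
      exact (ENNReal.mul_le_mul_iff_right (ENNReal.inv_ne_zero.2 (card_ne_top k))
        (ENNReal.inv_ne_top.2 (card_ne_zero k))).1 h5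
    have heq : ∫⁻ s in Ioo 0 t, rearr (Fi i).1 s ≤
        ∫⁻ x in A, ‖(Fi i : L0 α) x‖ₑ ∂lebesgueOn α := by
      rw [← Finset.add_sum_erase _ _ (Finset.mem_univ i),
        ← Finset.add_sum_erase _ _ (Finset.mem_univ i)] at hsum
      have hfin : ∑ j ∈ Finset.univ.erase i, ∫⁻ s in Ioo 0 t, rearr (Fi j).1 s ≠ ∞ :=
        ENNReal.sum_ne_top.2 fun j _ => lintegral_rearr_ne_top hE (Fi j) t
      refine (ENNReal.add_le_add_iff_right hfin).1 (hsum.trans ?_)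
      exact add_le_add le_rfl (Finset.sum_le_sum fun j _ => hle j)
    rcases ht0.eq_or_lt with h0 | h0
    -- At `t = 0` the rearrangement may be infinite; if it is finite it is the essential supremum.
    · rw [← h0]
      by_cases htop : rearr (Fi i).1 0 = ∞
      · rw [htop]; exact ae_of_all _ fun _ _ => le_top
      · have h5 := (rearrE_le_iff (Fi i).1 (ENNReal.ofReal 0) (rearr (Fi i).1 0).toNNReal).1
          (by rw [ENNReal.coe_toNNReal htop]; exact le_rfl)
        rw [ENNReal.ofReal_zero, nonpos_iff_eq_zero, distribution_eq] at h5
        filter_upwards [measure_eq_zero_iff_ae_notMem.1 h5] with x hx _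
        rw [ENNReal.coe_toNNReal htop] at hx
        exact not_lt.1 hx
    · have hfi := rearr_ne_top hE (Fi i) t h0
      set c := (rearr (Fi i).1 t).toNNReal with hc
      have hcc : (c : ℝ≥0∞) = rearr (Fi i).1 t := ENNReal.coe_toNNReal hfi
      have hmi : Measurable fun x => ‖(Fi i : L0 α) x‖ₑ - c :=
        (measurable_enorm_L0 _).sub_const _
      have h5 : excess (Fi i).1 c ≤ ∫⁻ x in A, (‖(Fi i : L0 α) x‖ₑ - c) ∂lebesgueOn α := by
        have h6 := heq.trans (setLIntegral_enorm_le (Fi i).1 A c)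
        rw [lintegral_Ioo_rearr_eq (rearr_ne_top hE (Fi i)) h0, hAt] at h6
        exact (ENNReal.add_le_add_iff_left
          (ENNReal.mul_ne_top ENNReal.coe_ne_top ENNReal.ofReal_ne_top)).1 h6
      have h7 : ∫⁻ x in A, (‖(Fi i : L0 α) x‖ₑ - c) ∂lebesgueOn α ≠ ∞ :=
        ne_top_of_le_ne_top (lintegral_rearr_ne_top hE (Fi i) t)
          ((lintegral_mono fun x => tsub_le_self).trans (hle i))
      rw [excess, ← lintegral_add_compl _ hAm] at h5
      -- The whole excess of `Fᵢ` at height `μ(t, Fᵢ)` sits on `A`, so `|Fᵢ|` does not exceed that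
      -- height off `A`.
      have h8 : ∫⁻ x in Aᶜ, (‖(Fi i : L0 α) x‖ₑ - c) ∂lebesgueOn α = 0 :=
        nonpos_iff_eq_zero.1 ((ENNReal.add_le_add_iff_left h7).1 (by simpa using h5))
      rw [lintegral_eq_zero_iff hmi, EventuallyEq, ae_restrict_iff' hAm.compl] at h8
      filter_upwards [h8] with x hx hxs
      rw [← hcc]
      exact tsub_eq_zero_iff_le.1 (hx (not_lt.2 hxs))

end Average

/-! ### Terms of an extremal average, and their transfer to equimeasurable functions. -/

section Transfer

variable {α : ℝ≥0∞} {E : NormedFunctionSpace α} {k : ℕ}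

/-- The values which `f` takes on the level sets of `|F|`, when the superlevel sets of `|F|` are
superlevel sets of `|f|`. -/
noncomputable def levelValue (F f : L0 α) (r : ℝ≥0) : ℝ≥0∞ :=
  ⨅ (s : ℝ≥0) (_ : r < s), rearrE f (distribution F s)

theorem levelValue_mono (F f : L0 α) : Monotone (levelValue F f) := fun _ _ h =>
  le_iInf₂ fun s hs => iInf₂_le s (h.trans_lt hs)

/-- The infimum over `s > r` in `levelValue` buys this right-continuity, needed at `r = μ(∞, F)`; it
also avoids `d(r, F)` itself, which may be infinite there. -/
theorem continuousWithinAt_levelValue (F f : L0 α) (r : ℝ≥0) :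
    ContinuousWithinAt (levelValue F f) (Ioi r) r := by
  refine tendsto_order.2 ⟨fun a ha => ?_, fun a ha => ?_⟩
  · filter_upwards [self_mem_nhdsWithin] with s hs
    exact ha.trans_le (levelValue_mono F f (le_of_lt hs))
  · obtain ⟨s, hs⟩ := iInf_lt_iff.1 ha
    obtain ⟨hrs, hs⟩ := iInf_lt_iff.1 hs
    filter_upwards [Ioo_mem_nhdsGT hrs] with r' hr'
    exact (iInf₂_le s hr'.2).trans_lt hs

/-- Equality in the triangle inequality: after rotation by the conjugate phase of `z`, every real
part must reach its bound `p i`. -/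
theorem eq_phase_mul_of_sum {ι : Type*} [Fintype ι] {z : ℂ} {y : ι → ℂ} {p : ι → ℝ} {n : ℝ}
    (hz : (n : ℂ) * z = ∑ i, y i) (hy : ∀ i, ‖y i‖ ≤ p i) (hp : ∑ i, p i ≤ n * ‖z‖) (i : ι) :
    y i = phase z * p i := by
  have hconj : (starRingEnd ℂ) (phase z) * phase z = 1 := by
    rw [mul_comm, Complex.mul_conj, Complex.normSq_eq_norm_sq, norm_phase]; simp
  have hn : ∀ j, ‖(starRingEnd ℂ) (phase z) * y j‖ ≤ p j := fun j => by
    rw [norm_mul, RCLike.norm_conj, norm_phase, one_mul]; exact hy j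
  have hre : ∀ j, ((starRingEnd ℂ) (phase z) * y j).re ≤ p j := fun j =>
    (Complex.re_le_norm _).trans (hn j)
  have hsum : ∑ j, ((starRingEnd ℂ) (phase z) * y j).re = ∑ j, p j := by
    refine le_antisymm (Finset.sum_le_sum fun j _ => hre j) (hp.trans (le_of_eq ?_))
    rw [← Complex.re_sum, ← Finset.mul_sum, ← hz]
    have : (starRingEnd ℂ) (phase z) * (n * z) = ((n * ‖z‖ : ℝ) : ℂ) := by
      conv_lhs => rw [← phase_mul_norm z]
      rw [phase_mul_norm]
      calc _ = n * ((starRingEnd ℂ) (phase z) * (phase z * ‖z‖)) := by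
            rw [phase_mul_norm]; ring
        _ = _ := by rw [← mul_assoc ((starRingEnd ℂ) (phase z)), hconj]; push_cast; ring
    rw [this, Complex.ofReal_re]
  have h := eq_of_re_eq_of_norm_le
    ((Finset.sum_eq_sum_iff_of_le fun j _ => hre j).1 hsum i (Finset.mem_univ i)) (hn i)
  rw [← h, ← mul_assoc, mul_comm (phase z), hconj, one_mul]

variable {F : L0 α} {Fi : Fin (k + 1) → E}

theorem sum_levelValue_le (hE : E.IsStronglySymmetric)
    (hF : F = (1 / ((k : ℂ) + 1)) • ∑ i, (Fi i : L0 α))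
    (hex : ∀ c, excess F c = ∫⁻ s in Ioi 0, (avgRearr Fi s - c)) {r : ℝ≥0}
    (hr : rearrAtInfty F ≤ r) :
    ∑ i, levelValue F (Fi i).1 r ≤ (k + 1 : ℕ) * r := by
  rw [mul_comm, ← ENNReal.div_le_iff_le_mul (Or.inl (card_ne_zero k)) (Or.inl (card_ne_top k))]
  refine ENNReal.le_of_forall_pos_le_add fun ε hε _ => ?_
  rw [← ENNReal.coe_add]
  have hlt : r < r + ε := lt_add_of_pos_right r hε
  have hd : distribution F (r + ε) ≠ ∞ :=
    (distribution_lt_top (hr.trans_lt (ENNReal.coe_lt_coe.2 hlt))).ne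
  refine le_trans ?_ (superlevel_of_excess_eq hE hF hex hd).1
  rw [ENNReal.div_eq_inv_mul, avgRearr]
  refine mul_le_mul' le_rfl (Finset.sum_le_sum fun i _ => ?_)
  rw [← rearrE_ofReal, ENNReal.ofReal_toReal hd]
  exact iInf₂_le _ hlt

theorem enorm_le_levelValue (hE : E.IsStronglySymmetric)
    (hF : F = (1 / ((k : ℂ) + 1)) • ∑ i, (Fi i : L0 α))
    (hex : ∀ c, excess F c = ∫⁻ s in Ioi 0, (avgRearr Fi s - c))
    (hv : ∀ᵐ x ∂lebesgueOn α, rearrAtInfty F ≤ ‖F x‖ₑ) :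
    ∀ᵐ x ∂lebesgueOn α, ∀ i, ‖(Fi i : L0 α) x‖ₑ ≤ levelValue F (Fi i).1 ‖F x‖₊ := by
  -- Rational levels leave only countably many exceptional null sets.
  have hall : ∀ᵐ x ∂lebesgueOn α, ∀ q : ℚ, ∀ i, distribution F (q : ℝ).toNNReal ≠ ∞ →
      ‖F x‖ₑ ≤ (q : ℝ).toNNReal →
      ‖(Fi i : L0 α) x‖ₑ ≤ rearrE (Fi i).1 (distribution F (q : ℝ).toNNReal) := by
    refine ae_all_iff.2 fun q => ae_all_iff.2 fun i => ?_
    by_cases hd : distribution F (q : ℝ).toNNReal = ∞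
    · exact ae_of_all _ fun x h => absurd hd h
    · filter_upwards [(superlevel_of_excess_eq hE hF hex hd).2 i] with x hx _ h
      have := hx h
      rwa [← rearrE_ofReal, ENNReal.ofReal_toReal hd] at this
  filter_upwards [hall, hv] with x hx hvx i
  refine le_iInf₂ fun s hs => ?_
  obtain ⟨q, hq1, hq2⟩ := exists_rat_btwn (NNReal.coe_lt_coe.2 hs)
  have hq0 : (0 : ℝ) ≤ q := (NNReal.coe_nonneg _).trans hq1.le
  have hq1' : ‖F x‖₊ < (q : ℝ).toNNReal := by
    rwa [← NNReal.coe_lt_coe, Real.coe_toNNReal _ hq0]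
  have hq2' : (q : ℝ).toNNReal ≤ s := by
    rw [← NNReal.coe_le_coe, Real.coe_toNNReal _ hq0]; exact hq2.le
  have hlt : ‖F x‖ₑ < (q : ℝ).toNNReal := by
    rw [enorm_eq_nnnorm]; exact ENNReal.coe_lt_coe.2 hq1'
  exact (hx q i (distribution_lt_top (hvx.trans_lt hlt)).ne hlt.le).trans
    (rearrE_antitone _ (distribution_antitone F hq2'))

/-- The terms of an average whose rearrangement is the average of the rearrangements are functions
of the average. -/
theorem eq_phase_mul_levelValue (hE : E.IsStronglySymmetric)
    (hF : F = (1 / ((k : ℂ) + 1)) • ∑ i, (Fi i : L0 α))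
    (hex : ∀ c, excess F c = ∫⁻ s in Ioi 0, (avgRearr Fi s - c))
    (hv : ∀ᵐ x ∂lebesgueOn α, rearrAtInfty F ≤ ‖F x‖ₑ) :
    ∀ᵐ x ∂lebesgueOn α, ∀ i,
      (Fi i : L0 α) x = phase (F x) * ((levelValue F (Fi i).1 ‖F x‖₊).toReal : ℝ) := by
  filter_upwards [enorm_le_levelValue hE hF hex hv, hv, avg_ae_eq hF] with x h1 h2 h3
  rw [enorm_eq_nnnorm] at h2
  have hsum := sum_levelValue_le hE hF hex h2
  have htop : ((k + 1 : ℕ) : ℝ≥0∞) * ‖F x‖₊ ≠ ∞ :=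
    ENNReal.mul_ne_top (card_ne_top k) ENNReal.coe_ne_top
  have hfin : ∀ i ∈ Finset.univ, levelValue F (Fi i).1 ‖F x‖₊ ≠ ∞ :=
    ENNReal.sum_ne_top.1 (ne_top_of_le_ne_top htop hsum)
  refine eq_phase_mul_of_sum (n := k + 1) (by push_cast; exact h3) (fun i => ?_) ?_
  · rw [← toReal_enorm]
    exact ENNReal.toReal_mono (hfin i (Finset.mem_univ i)) (h1 i)
  · rw [← ENNReal.toReal_sum hfin]
    refine (ENNReal.toReal_mono htop hsum).trans (le_of_eq ?_)
    rw [ENNReal.toReal_mul, ENNReal.toReal_natCast]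
    simp

section Equimeasurable

variable {F G : L0 α}

/-- Above `μ(∞)` all superlevel sets have finite measure, so distribution functions determine the
law of the modulus there. At the level `v = μ(∞)` itself they need not, which is why that level is
treated separately below. -/
theorem map_nnnorm_restrict_Ioi_eq (hd : ∀ s, distribution F s = distribution G s) {v : ℝ≥0}
    (hv : rearrAtInfty F ≤ v) :
    ((lebesgueOn α).map fun x => ‖F x‖₊).restrict (Ioi v) =
      ((lebesgueOn α).map fun x => ‖G x‖₊).restrict (Ioi v) := by
  have hap : ∀ (f : L0 α) (a : ℝ≥0), (lebesgueOn α).map (fun x => ‖f x‖₊) (Ioi a) =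
      distribution f a := by
    intro f a
    rw [Measure.map_apply f.measurable.nnnorm measurableSet_Ioi]
    rfl
  obtain ⟨u, hu, hlt, hlim⟩ := exists_seq_strictAnti_tendsto v
  have hU : Ioi v = ⋃ n, Ioi (u n) := by
    ext a
    simp only [mem_Ioi, mem_iUnion]
    exact ⟨fun h => ((tendsto_order.1 hlim).2 a h).exists, fun ⟨n, hn⟩ => (hlt n).trans hn⟩
  rw [hU, Measure.restrict_iUnion_congr]
  intro n
  have hfin : distribution F (u n) ≠ ∞ :=
    (distribution_lt_top (hv.trans_lt (ENNReal.coe_lt_coe.2 (hlt n)))).ne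
  have : IsFiniteMeasure (((lebesgueOn α).map fun x => ‖F x‖₊).restrict (Ioi (u n))) :=
    ⟨by rw [Measure.restrict_apply_univ, hap]; exact lt_top_iff_ne_top.2 hfin⟩
  refine Measure.ext_of_Iic _ _ fun a => ?_
  rw [Measure.restrict_apply measurableSet_Iic, Measure.restrict_apply measurableSet_Iic]
  rcases le_or_gt (u n) a with h | h
  · have hset : Iic a ∩ Ioi (u n) = Ioi (u n) \ Ioi a := by
      ext b; simp [and_comm]
    have hfa : ∀ f : L0 α, distribution f a = distribution F a →
        (lebesgueOn α).map (fun x => ‖f x‖₊) (Ioi a) ≠ ∞ := by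
      intro f hf
      rw [hap, hf]
      exact ne_top_of_le_ne_top hfin (distribution_antitone F h)
    rw [hset, measure_sdiff (Ioi_subset_Ioi h) measurableSet_Ioi.nullMeasurableSet (hfa F rfl),
      measure_sdiff (Ioi_subset_Ioi h) measurableSet_Ioi.nullMeasurableSet (hfa G (hd a).symm),
      hap, hap, hap, hap, hd, hd]
  · have hset : Iic a ∩ Ioi (u n) = ∅ := by
      ext b
      simp only [mem_inter_iff, mem_Iic, mem_Ioi, mem_empty_iff_false, iff_false, not_and, not_lt]
      exact fun hb => hb.trans h.le
    rw [hset, measure_empty, measure_empty]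

theorem measure_preimage_eq (hd : ∀ s, distribution F s = distribution G s) {v : ℝ≥0}
    (hv : rearrAtInfty F ≤ v) {B : Set ℝ≥0} (hB : MeasurableSet B) (hBv : B ⊆ Ioi v) :
    lebesgueOn α {x | ‖F x‖₊ ∈ B} = lebesgueOn α {x | ‖G x‖₊ ∈ B} := by
  have h := congrArg (fun m : Measure ℝ≥0 => m B) (map_nnnorm_restrict_Ioi_eq hd hv)
  simp only [Measure.restrict_apply hB, inter_eq_left.2 hBv,
    Measure.map_apply F.measurable.nnnorm hB, Measure.map_apply G.measurable.nnnorm hB] at h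
  exact h

theorem measure_preimage_le (hd : ∀ s, distribution F s = distribution G s) {v : ℝ≥0}
    (hv : rearrAtInfty F = v) (hF : ∀ᵐ x ∂lebesgueOn α, v ≤ ‖F x‖₊)
    (hG : ∀ᵐ x ∂lebesgueOn α, v ≤ ‖G x‖₊) {J : Set ℝ≥0} (hJ : MeasurableSet J)
    (hup : IsUpperSet J) :
    lebesgueOn α {x | ‖G x‖₊ ∈ J} ≤ lebesgueOn α {x | ‖F x‖₊ ∈ J} := by
  by_cases hvJ : v ∈ J
  · refine measure_mono_ae ?_
    filter_upwards [hF] with x hx _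
    exact hup hx hvJ
  · calc lebesgueOn α {x | ‖G x‖₊ ∈ J} ≤ lebesgueOn α {x | ‖G x‖₊ ∈ J ∩ Ioi v} := by
          refine measure_mono_ae ?_
          filter_upwards [hG] with x hx (hxJ : ‖G x‖₊ ∈ J)
          exact ⟨hxJ, lt_of_le_of_ne hx fun hh => hvJ (hh ▸ hxJ)⟩
      _ = lebesgueOn α {x | ‖F x‖₊ ∈ J ∩ Ioi v} :=
          (measure_preimage_eq hd hv.le (hJ.inter measurableSet_Ioi) inter_subset_right).symm
      _ ≤ _ := measure_mono fun x hx => hx.1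

/-- Equations satisfied by the values of `G` are satisfied by those of `F`. -/
theorem ae_eq_zero_transfer (hd : ∀ s, distribution F s = distribution G s) {v : ℝ≥0}
    (hv : rearrAtInfty F = v) (hF : ∀ᵐ x ∂lebesgueOn α, v ≤ ‖F x‖₊)
    (hG : ∀ᵐ x ∂lebesgueOn α, v ≤ ‖G x‖₊) {ψ : ℝ≥0 → ℂ} (hψ : Measurable ψ)
    (hψv : ContinuousWithinAt ψ (Ioi v) v) (h : ∀ᵐ x ∂lebesgueOn α, ψ ‖G x‖₊ = 0) :
    ∀ᵐ x ∂lebesgueOn α, ψ ‖F x‖₊ = 0 := by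
  have hB : MeasurableSet ({r | ψ r ≠ 0} ∩ Ioi v) :=
    (hψ (measurableSet_singleton 0)).compl.inter measurableSet_Ioi
  have hnull : ∀ᵐ x ∂lebesgueOn α, v < ‖F x‖₊ → ψ ‖F x‖₊ = 0 := by
    have h1 : lebesgueOn α {x | ‖F x‖₊ ∈ {r | ψ r ≠ 0} ∩ Ioi v} = 0 := by
      rw [measure_preimage_eq hd hv.le hB inter_subset_right]
      refine measure_eq_zero_iff_ae_notMem.2 ?_
      filter_upwards [h] with x hx hx'
      exact hx'.1 hx
    filter_upwards [measure_eq_zero_iff_ae_notMem.1 h1] with x hx hvx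
    by_contra hne
    exact hx ⟨hne, hvx⟩
  by_cases hψ0 : ψ v = 0
  · filter_upwards [hnull, hF] with x h1 h2
    rcases h2.eq_or_lt with h3 | h3
    · rw [← h3]; exact hψ0
    · exact h1 h3
  -- If `ψ v ≠ 0`, right-continuity gives `ψ ≠ 0` on some `[v, s]`, so `|G| > s` almost everywhere.
  -- Then `d(s, F)` is the full measure and finite, hence `|F| > s` almost everywhere too.
  · have hev : ∀ᶠ r in 𝓝[>] v, ψ r ≠ 0 :=
      hψv (isOpen_compl_singleton.mem_nhds hψ0)
    obtain ⟨u, hu, hsub⟩ := (mem_nhdsGT_iff_exists_Ioo_subset (a := v)).1 hev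
    obtain ⟨s, hvs, hsu⟩ := exists_between (show v < u from hu)
    have hGs : ∀ᵐ x ∂lebesgueOn α, s < ‖G x‖₊ := by
      filter_upwards [h, hG] with x h1 h2
      by_contra! hle
      rcases h2.eq_or_lt with h3 | h3
      · rw [← h3] at h1; exact hψ0 h1
      · exact hsub ⟨h3, hle.trans_lt hsu⟩ h1
    have huniv : distribution F s = lebesgueOn α univ := by
      rw [hd]
      exact measure_congr (by filter_upwards [hGs] with x hx; exact propext ⟨fun _ => trivial, fun _ => hx⟩)
    have hfin : distribution F s ≠ ∞ :=
      (distribution_lt_top (hv.le.trans_lt (ENNReal.coe_lt_coe.2 hvs))).ne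
    have hFs : ∀ᵐ x ∂lebesgueOn α, s < ‖F x‖₊ := by
      have hm : MeasurableSet {x | (s : ℝ) < ‖F x‖} :=
        measurableSet_lt measurable_const F.measurable.norm
      have := measure_compl hm hfin
      rw [show lebesgueOn α {x | (s : ℝ) < ‖F x‖} = lebesgueOn α univ from huniv, tsub_self] at this
      exact this
    filter_upwards [hnull, hFs] with x h1 h2 using h1 (hvs.trans h2)

end Equimeasurable

/-- `k`-extremality passes between equimeasurable functions which are nowhere smaller than the
limit of their rearrangement at infinity. -/
theorem NormedFunctionSpace.IsKExtremeIn.of_distribution_eq (hE : E.IsStronglySymmetric)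
    {F G : L0 α} (hd : ∀ s, distribution F s = distribution G s)
    (hF : ∀ᵐ x ∂lebesgueOn α, rearrAtInfty F ≤ ENNReal.ofReal ‖F x‖)
    (hG : ∀ᵐ x ∂lebesgueOn α, rearrAtInfty G ≤ ENNReal.ofReal ‖G x‖)
    (h : E.IsKExtremeIn k G) : E.IsKExtremeIn k F := by
  obtain ⟨hGm, hGk⟩ := h
  obtain ⟨hFm, hFG⟩ := hE.toIsSymmetric.mem_of_distribution_le (f := F) ⟨G, hGm⟩ fun s => (hd s).le
  obtain ⟨_, hGF⟩ := hE.toIsSymmetric.mem_of_distribution_le (f := G) ⟨F, hFm⟩ fun s => (hd s).ge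
  refine ⟨hFm, (le_antisymm hFG hGF).trans hGk.1, fun Fi hFi hFavg hind => ?_⟩
  have hF' : F = (1 / ((k : ℂ) + 1)) • ∑ i, (Fi i : L0 α) := by
    have := congrArg Subtype.val hFavg
    simpa using this
  obtain ⟨w, hw, hwex⟩ := exists_avg_rearrL0 hE Fi hFi
  -- `F` has the excess of `G`, and since `G` is `k`-extreme the upper bound from the averaged
  -- rearrangements is attained.
  have hex : ∀ c, excess F c = ∫⁻ s in Ioi 0, (avgRearr Fi s - c) := by
    intro c
    rw [← hwex, excess_eq_of_distribution_eq hd]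
    refine excess_eq_of_isKExtreme hE hGk hw (fun c => ?_) c
    rw [hwex, ← excess_eq_of_distribution_eq hd]
    exact excess_avg_le hE hF' c
  have hrearr : ∀ T, rearrE F T = rearrE G T := fun T =>
    le_antisymm (rearrE_mono_of_distribution_le (fun s => (hd s).le) T)
      (rearrE_mono_of_distribution_le (fun s => (hd s).ge) T)
  have hinf : rearrAtInfty F = rearrAtInfty G := iInf_congr fun t => hrearr _
  obtain ⟨v, hv⟩ : ∃ v : ℝ≥0, rearrAtInfty F = v :=
    ⟨_, (ENNReal.coe_toNNReal (rearrAtInfty_ne_top hE ⟨F, hFm⟩)).symm⟩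
  have hFv' : ∀ᵐ x ∂lebesgueOn α, rearrAtInfty F ≤ ‖F x‖ₑ := by simpa only [ofReal_norm] using hF
  have hFv : ∀ᵐ x ∂lebesgueOn α, v ≤ ‖F x‖₊ := by
    filter_upwards [hFv'] with x hx
    rwa [hv, enorm_eq_nnnorm, ENNReal.coe_le_coe] at hx
  have hGv : ∀ᵐ x ∂lebesgueOn α, v ≤ ‖G x‖₊ := by
    filter_upwards [hG] with x hx
    rwa [← hinf, hv, ofReal_norm, enorm_eq_nnnorm, ENNReal.coe_le_coe] at hx
  set φ : Fin (k + 1) → ℝ≥0 → ℝ≥0∞ := fun i => levelValue F (Fi i).1 with hφ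
  have hφm : ∀ i, Measurable (φ i) := fun i => (levelValue_mono F (Fi i).1).measurable
  have hφsum : ∀ r, v ≤ r → ∑ i, φ i r ≤ (k + 1 : ℕ) * r := fun r hr =>
    sum_levelValue_le hE hF' hex (by rw [hv]; exact ENNReal.coe_le_coe.2 hr)
  have hφfin : ∀ r, v ≤ r → ∀ i, φ i r ≠ ∞ := fun r hr i =>
    ENNReal.sum_ne_top.1 (ne_top_of_le_ne_top
      (ENNReal.mul_ne_top (card_ne_top k) ENNReal.coe_ne_top) (hφsum r hr)) i (Finset.mem_univ i)
  have hψm : ∀ i, Measurable fun r => (((φ i r).toReal : ℝ) : ℂ) := fun i =>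
    Complex.measurable_ofReal.comp (hφm i).ennreal_toReal
  have hψc : ∀ i, ContinuousWithinAt (fun r => (((φ i r).toReal : ℝ) : ℂ)) (Ioi v) v := fun i =>
    (Complex.continuous_ofReal.tendsto _).comp ((ENNReal.tendsto_toReal (hφfin v le_rfl i)).comp
      (continuousWithinAt_levelValue F (Fi i).1 v))
  have hal := eq_phase_mul_levelValue hE hF' hex hFv'
  have hFsum : ∀ᵐ x ∂lebesgueOn α,
      ∑ i, (((φ i ‖F x‖₊).toReal : ℝ) : ℂ) - ((k : ℂ) + 1) * (‖F x‖₊ : ℝ) = 0 := by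
    filter_upwards [hal, avg_ae_eq hF'] with x h1 h2
    refine (mul_eq_zero.1 (?_ : phase (F x) * _ = 0)).resolve_left (phase_ne_zero (F x))
    rw [mul_sub, Finset.mul_sum, ← Finset.sum_congr rfl fun i _ => h1 i, ← h2, coe_nnnorm,
      mul_left_comm, phase_mul_norm, sub_self]
  -- The identity `∑ φᵢ(r) = (k + 1) r` holds on the values of `|F|` and is carried over to those of
  -- `|G|`.
  have hGsum := ae_eq_zero_transfer (F := G) (G := F) (fun s => (hd s).symm) (hinf ▸ hv) hGv hFv
    (ψ := fun r => ∑ i, (((φ i r).toReal : ℝ) : ℂ) - ((k : ℂ) + 1) * (r : ℝ))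
    ((Finset.measurable_sum _ fun i _ => hψm i).sub (by fun_prop))
    ((tendsto_finsetSum _ fun i _ => hψc i).sub
      (Continuous.continuousWithinAt (f := fun r : ℝ≥0 => ((k : ℂ) + 1) * ((r : ℝ) : ℂ))
        (by fun_prop))) hFsum
  set Gi : Fin (k + 1) → L0 α := fun i => AEEqFun.mk
    (fun x => phase (G x) * ((φ i ‖G x‖₊).toReal : ℝ))
    ((measurable_phase.comp G.measurable).mul
      ((hψm i).comp G.measurable.nnnorm)).aestronglyMeasurable with hGidef
  have hGi : ∀ i, Gi i =ᵐ[lebesgueOn α] fun x => phase (G x) * ((φ i ‖G x‖₊).toReal : ℝ) :=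
    fun i => AEEqFun.coeFn_mk _ _
  have hphase : ∀ (z : ℂ) {p : ℝ≥0∞}, p ≠ ∞ → ‖phase z * (p.toReal : ℝ)‖ₑ = p := by
    intro z p hp
    rw [enorm_mul, ← ofReal_norm, norm_phase, ENNReal.ofReal_one, one_mul, ← ofReal_norm,
      Complex.norm_real, Real.norm_of_nonneg ENNReal.toReal_nonneg, ENNReal.ofReal_toReal hp]
  have hdist : ∀ i s, distribution (Gi i) s ≤ distribution (Fi i).1 s := by
    intro i s
    have hJ : MeasurableSet {r | (s : ℝ≥0∞) < φ i r} := measurableSet_lt measurable_const (hφm i)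
    have hup : IsUpperSet {r | (s : ℝ≥0∞) < φ i r} := fun a b hab (ha : (s : ℝ≥0∞) < φ i a) =>
      ha.trans_le (levelValue_mono F (Fi i).1 hab)
    rw [distribution_eq, distribution_eq]
    calc lebesgueOn α {x | (s : ℝ≥0∞) < ‖Gi i x‖ₑ}
        ≤ lebesgueOn α {x | ‖G x‖₊ ∈ {r | (s : ℝ≥0∞) < φ i r}} := by
          refine measure_mono_ae ?_
          filter_upwards [hGi i, hGv] with x h1 h2 (h3 : _ < _)
          rw [h1, hphase _ (hφfin _ h2 i)] at h3
          exact h3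
      _ ≤ lebesgueOn α {x | ‖F x‖₊ ∈ {r | (s : ℝ≥0∞) < φ i r}} :=
          measure_preimage_le hd hv hFv hGv hJ hup
      _ ≤ _ := by
          refine measure_mono_ae ?_
          filter_upwards [hal, hFv] with x h1 h2 (h3 : _ < _)
          change _ < _
          rw [h1 i, hphase _ (hφfin _ h2 i)]
          exact h3
  choose hGim hGin using fun i => hE.toIsSymmetric.mem_of_distribution_le (Fi i) (hdist i)
  set Gv : Fin (k + 1) → E := fun i => ⟨Gi i, hGim i⟩ with hGv'
  have hk : (k : ℂ) + 1 ≠ 0 := by exact_mod_cast Nat.succ_ne_zero k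
  have hGavg : (⟨G, hGm⟩ : E) = (1 / ((k : ℂ) + 1)) • ∑ i, Gv i := by
    refine Subtype.ext (AEEqFun.ext ?_)
    have hcoe : (((1 / ((k : ℂ) + 1)) • ∑ i, Gv i : E) : L0 α) =
        ∑ i, (1 / ((k : ℂ) + 1)) • Gi i := by
      simp [Finset.smul_sum, hGv']
    rw [hcoe]
    filter_upwards [coeFn_sum_smul (fun _ : Fin (k + 1) => 1 / ((k : ℂ) + 1)) Gi,
      ae_all_iff.2 hGi, hGsum] with x h1 h2 h3
    rw [h1, ← Finset.mul_sum, Finset.sum_congr rfl fun i _ => h2 i, ← Finset.mul_sum,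
      sub_eq_zero.1 h3, coe_nnnorm, mul_left_comm (phase _), phase_mul_norm, ← mul_assoc,
      one_div_mul_cancel hk, one_mul]
  have hGle : ∀ i, ‖Gv i‖ ≤ 1 := fun i => (hGin i).trans (hFi i).le
  have hGnorm : ∀ i, ‖Gv i‖ = 1 := by
    -- An average of norm `1` of vectors of norm at most `1` forces every norm to be `1`.
    have hsum : ∑ i, ‖Gv i‖ = ∑ _i : Fin (k + 1), (1 : ℝ) := by
      refine le_antisymm (Finset.sum_le_sum fun i _ => hGle i) ?_
      have h1 : ((k : ℂ) + 1) • (⟨G, hGm⟩ : E) = ∑ i, Gv i := by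
        rw [hGavg, smul_smul, mul_one_div_cancel hk, one_smul]
      calc ∑ _i : Fin (k + 1), (1 : ℝ) = ‖((k : ℂ) + 1) • (⟨G, hGm⟩ : E)‖ := by
            rw [norm_smul, hGk.1, ← Nat.cast_succ, Complex.norm_natCast]; simp
        _ ≤ _ := by rw [h1]; exact norm_sum_le _ _
    exact fun i => (Finset.sum_eq_sum_iff_of_le fun i _ => hGle i).1 hsum i (Finset.mem_univ i)
  refine hGk.2 Gv hGnorm hGavg ?_
  rw [Fintype.linearIndependent_iff] at hind ⊢
  intro c hc
  refine hind c (Subtype.ext (AEEqFun.ext ?_))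
  have hGzero : ∀ᵐ x ∂lebesgueOn α, ∑ i, c i * (((φ i ‖G x‖₊).toReal : ℝ) : ℂ) = 0 := by
    have hcoe : ((∑ i, c i • Gv i : E) : L0 α) = ∑ i, c i • Gi i := by simp [hGv']
    rw [hc] at hcoe
    have h0 := coeFn_sum_smul c Gi
    rw [← hcoe] at h0
    filter_upwards [h0, ae_all_iff.2 hGi, AEEqFun.coeFn_zero (μ := lebesgueOn α) (β := ℂ)]
      with x h1 h2 h3
    refine (mul_eq_zero.1 (?_ : phase (G x) * _ = 0)).resolve_left (phase_ne_zero (G x))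
    have h4 : (0 : L0 α) x = ∑ i, c i * Gi i x := h1
    rw [h3] at h4
    refine Eq.trans ?_ h4.symm
    rw [Finset.mul_sum]
    exact Finset.sum_congr rfl fun i _ => by rw [h2 i]; ring
  -- A linear relation is again an equation in the modulus alone, now carried from `G` back to `F`.
  have hFzero := ae_eq_zero_transfer hd hv hFv hGv
    (ψ := fun r => ∑ i, c i * (((φ i r).toReal : ℝ) : ℂ))
    (Finset.measurable_sum _ fun i _ => (hψm i).const_mul _)
    (tendsto_finsetSum _ fun i _ => (hψc i).const_mul _) hGzero
  have hcoe : ((∑ i, c i • Fi i : E) : L0 α) = ∑ i, c i • (Fi i : L0 α) := by simp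
  rw [hcoe]
  filter_upwards [coeFn_sum_smul c fun i => (Fi i : L0 α), hal, hFzero,
    AEEqFun.coeFn_zero (μ := lebesgueOn α) (β := ℂ)] with x h1 h2 h3 h4
  rw [h1]
  refine Eq.trans ?_ h4.symm
  calc ∑ i, c i * (Fi i : L0 α) x
      = phase (F x) * ∑ i, c i * (((φ i ‖F x‖₊).toReal : ℝ) : ℂ) := by
        rw [Finset.mul_sum]
        exact Finset.sum_congr rfl fun i _ => by rw [h2 i]; ring
    _ = 0 := by rw [h3, mul_zero]

end Transfer

theorem rearrAtInfty_le_rearrL0 {α : ℝ≥0∞} {f : L0 α} (hf : ∀ t, 0 < t → rearr f t ≠ ∞) :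
    ∀ᵐ t ∂lebesgueOn α, rearrAtInfty (rearrL0 f) ≤ ENNReal.ofReal ‖rearrL0 f t‖ := by
  have hle : rearrAtInfty (rearrL0 f) ≤ rearrAtInfty f :=
    iInf_mono fun t => rearrE_mono_of_distribution_le (fun s => (distribution_rearrL0 hf s).le) _
  filter_upwards [enorm_rearrL0_ae_eq hf] with t ht
  rw [ofReal_norm, ht]
  exact hle.trans (iInf_le _ t)

theorem mainTheorem5 (α : ℝ≥0∞) (hα : 0 < α) (E : NormedFunctionSpace α)
    (hE : E.IsStronglySymmetric) (k : ℕ) (hk : 1 ≤ k) (f : L0 α) :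
    E.IsKExtremeIn k f ↔
      E.IsKExtremeIn k (rearrL0 f) ∧
        ∀ᵐ t ∂(lebesgueOn α), rearrAtInfty f ≤ ENNReal.ofReal ‖f t‖ := by
  constructor
  · intro h
    have hf := rearr_ne_top hE ⟨f, h.1⟩
    have hv := rearrAtInfty_le_of_isKExtreme hE h.2
    exact ⟨h.of_distribution_eq hE (distribution_rearrL0 hf) (rearrAtInfty_le_rearrL0 hf) hv, hv⟩
  · rintro ⟨h, hv⟩
    -- An identically infinite `μ(f)` would make `rearrL0 f` zero, which has norm `0`, not `1`.
    have hf : ∀ t, 0 < t → rearr f t ≠ ∞ := by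
      refine rearr_ne_top_of_rearrL0_ne_zero fun h0 => ?_
      obtain ⟨hm, hn, -⟩ := h
      have : (⟨rearrL0 f, hm⟩ : E) = 0 := Subtype.ext h0
      rw [this, norm_zero] at hn
      exact zero_ne_one hn
    exact h.of_distribution_eq hE (fun s => (distribution_rearrL0 hf s).symm) hv
      (rearrAtInfty_le_rearrL0 hf)
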